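/- **Notation.** $L^p$ spaces consist of complex functions; $\langle f,h\rangle=\int f\,\overline h$; $\mathcal F f(\xi)=\int f(x)e^{-2\pi i\xi\cdot x}dx$, extended to $L^2$; $T_bf(x)=f(x-b)$. For $s\in\mathbb R$, $a\in\mathbb R\setminus\{0\}$ put $$N_s=\begin{pmatrix}1&-s\\0&1\end{pmatrix},\quad A_a=a\begin{pmatrix}1&0\\0&|a|^{-1/2}\end{pmatrix},\quad \tilde N_s=\begin{pmatrix}1&0\\-s&1\end{pmatrix},\quad \tilde A_a=a\begin{pmatrix}|a|^{-1/2}&0\\0&1\end{pmatrix},$$ $\mathcal S_\psi f(b,s,a)=\langle f,\,|a|^{-3/4}\psi(A_a^{-1}N_s^{-1}(\cdot-b))\rangle$, $\mathcal S^{\mathbf v}_\psi f(b,s,a)=\langle f,\,|a|^{-3/4}\psi(\tilde A_a^{-1}\tilde N_s^{-1}(\cdot-b))\rangle$, and, on $\mathbb R$, $\mathcal W_\chi u(b,a)=\langle u,\,|a|^{-1/2}\chi((\cdot-b)/a)\rangle$. The affine Radon transforms are $\mathcal Rf(v,t)=\int_{\mathbb R}f(t-vy,y)\,dy$ and $\mathcal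 R^{\mathbf v}f(v,t)=\int_{\mathbb R}f(x,t-vx)\,dx$. $\mathcal J_0$ is the operator on $L^2(\mathbb R)$ with $\mathcal F(\mathcal J_0u)(\tau)=|\tau|^{1/2}\mathcal Fu(\tau)$ and domain $\{u:|\tau|^{1/2}\mathcal Fu\in L^2(\mathbb R)\}$. **Angular partition.** Let $0<\epsilon<\pi/4$ and $$U=(-\pi,-\tfrac34\pi+\epsilon)\cup(-\tfrac\pi4-\epsilon,\tfrac\pi4+\epsilon)\cup(\tfrac34\pi-\epsilon,\pi],\qquad U^{\mathbf v}=(-\tfrac34\pi-\epsilon,-\tfrac\pi4+\epsilon)\cup(\tfrac\pi4-\epsilon,\tfrac34\pi+\epsilon).$$ Let $\varphi,\varphi^{\mathbf v}$ be real $C^\infty$ functions on the circle $S^1\simeq(-\pi,\pi]$ (equivalently, smooth $2\pi$-periodic functions of the angle) that are even on $S^1$, i.e. take equal values at antipodal points ($\varphi(\theta+\pi)=\varphi(\theta)$, likewise $\varphi^{\mathbf v}$), with $\operatorname{supp}\varphi\subseteq U$, $\operatorname{supp}\varphi^{\mathbf v}\subseteq U^{\mathbf v}$ and $\varphi^2+(\varphi^{\mathbf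 v})^2=1$. For $\xi\ne0$ with polar angle $\theta_\xi$ let $\Phi(\xi)=\varphi(\theta_\xi)$, $\Phi^{\mathbf v}(\xi)=\varphi^{\mathbf v}(\theta_\xi)$, and define $L,L^{\mathbf v}$ on $L^2(\mathbb R^2)$ by $\mathcal F(Lf)=\Phi\,\mathcal Ff$, $\mathcal F(L^{\mathbf v}f)=\Phi^{\mathbf v}\,\mathcal Ff$. **Shearlet.** Let $\psi\in L^2(\mathbb R^2)$, $\psi_1,\psi_2\in L^2(\mathbb R)$ satisfy $\mathcal F\psi(\xi_1,\xi_2)=\mathcal F\psi_1(\xi_1)\,\mathcal F\psi_2(\xi_2/\xi_1)$ for a.e. $\xi$, $\int_{\mathbb R^2}|\mathcal F\psi(\xi)|^2|\xi_1|^{-2}d\xi=1$, $0<\int|\mathcal F\psi_1(\tau)|^2|\tau|^{-1}d\tau<\infty$, $\int|\tau||\mathcal F\psi_1(\tau)|^2d\tau<\infty$ and $\int|\tau|^2|\mathcal F\psi_1(\tau)|^2d\tau<\infty$. Put $\mathcal F\psi^{\mathbf v}(\xi_1,\xi_2)=\mathcal F\psi(\xi_2,\xi_1)$, $\mathcal F\chi_1(\tau)=|\tau|\mathcal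 F\psi_1(\tau)$, $\phi_2=\mathcal F\psi_2$. **Theorem 4.1.** Let $g\in L^1(\mathbb R^2)\cap L^2(\mathbb R^2)$ be a $C^\infty$ function such that for a.e. $\xi\in\mathbb R^2$ $$|\mathcal Fg(\xi)|^2+\Phi(\xi)^2\int_{-1}^1\int_{-2}^2|\mathcal F\psi(A_a\,{}^tN_s\xi)|^2\,ds\frac{da}{|a|^{3/2}}+\Phi^{\mathbf v}(\xi)^2\int_{-1}^1\int_{-2}^2|\mathcal F\psi^{\mathbf v}(\tilde A_aN_s\xi)|^2\,ds\frac{da}{|a|^{3/2}}=1 .$$ Then for every $f\in L^1(\mathbb R^2)\cap L^2(\mathbb R^2)$ $$\|f\|_2^2=\int_{\mathbb R^2}|\langle f,T_bg\rangle|^2db+\int_{-1}^1\int_{-2}^2\int_{\mathbb R^2}|\mathcal S_\psi[Lf](b,s,a)|^2db\,ds\frac{da}{|a|^3}+\int_{-1}^1\int_{-2}^2\int_{\mathbb R^2}|\mathcal S^{\mathbf v}_{\psi^{\mathbf v}}[L^{\mathbf v}f](b,s,a)|^2db\,ds\frac{da}{|a|^3}.$$ Moreover $\mathcal Rf(v,\cdot),\mathcal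 R^{\mathbf v}f(v,\cdot)\in L^2(\mathbb R)$ for a.e. $v$, and for all $x,y,s\in\mathbb R$, $a\ne0$, with absolutely convergent integrals over $v$, $$\mathcal S_\psi[Lf](x,y,s,a)=|a|^{-3/4}\int_{\mathbb R}\mathcal W_{\chi_1}(\mathcal Rf(v,\cdot))(x+vy,a)\,\overline{\phi_2\Big(\frac{v-s}{|a|^{1/2}}\Big)}\,\varphi(\arctan v)\,dv,$$ $$\mathcal S^{\mathbf v}_{\psi^{\mathbf v}}[L^{\mathbf v}f](x,y,s,a)=|a|^{-3/4}\int_{\mathbb R}\mathcal W_{\chi_1}(\mathcal R^{\mathbf v}f(v,\cdot))(vx+y,a)\,\overline{\phi_2\Big(\frac{v-s}{|a|^{1/2}}\Big)}\,\varphi^{\mathbf v}\Big(\arctan\frac1v\Big)\,dv .$$ Finally $\mathcal Rg(v,\cdot)\in L^2(\mathbb R)$ and $\mathcal Rf(v,\cdot),\mathcal Rg(v,\cdot)\in\operatorname{dom}\mathcal J_0$ for a.e. $v$, and for all $x,y\in\mathbb R$ $$\langle f,T_{(x,y)}g\rangle=\int_{\mathbb R}\langle\mathcal J_0\mathcal Rf(v,\cdot),\,T_{x+vy}\,\mathcal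 J_0\mathcal Rg(v,\cdot)\rangle\,dv ;$$ if moreover $\mathcal J_0\mathcal Rg(v,\cdot)\in\operatorname{dom}\mathcal J_0$ for a.e. $v$, so that $\zeta(v,\cdot)=\mathcal J_0^2\mathcal Rg(v,\cdot)\in L^2(\mathbb R)$ is defined, then also $$\langle f,T_{(x,y)}g\rangle=\int_{\mathbb R}\langle\mathcal Rf(v,\cdot),\,T_{x+vy}\,\zeta(v,\cdot)\rangle\,dv ,$$ again with absolutely convergent integrals over $v$. -/

import Mathlib

open MeasureTheory Set
open scoped FourierTransform ContDiff ENNReal ComplexConjugate Matrix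

noncomputable section

namespace ConeShearlet

/-- The Euclidean plane. -/
abbrev Plane : Type := EuclideanSpace ℝ (Fin 2)

/-- The Hilbert space `L²(V)` of complex functions, for Lebesgue measure. On it `𝓕` and `𝓕⁻` are
the (unitary) Fourier transform and its inverse, normalised by `exp (-2πi ξ·x)`. -/
abbrev L2 (V : Type*) [MeasureSpace V] : Type _ := Lp ℂ 2 (volume : Measure V)

/-- The scalar product `⟨f, h⟩ = ∫ f(x) conj (h(x)) dx`, linear in the first argument. Translations
`T_b f(x) = f(x - b)` are Mathlib's `translate b f`. -/
def pairing {V : Type*} [MeasureSpace V] (f h : V → ℂ) : ℂ := ∫ x, f x * conj (h x)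

/-- The class in `L²(ℝ)` of a square-integrable function (and `0` if `u` is not one). -/
def toL2 (u : ℝ → ℂ) : L2 ℝ :=
  open Classical in if h : MemLp u 2 volume then h.toLp u else 0

/-! ### Fourier multipliers -/

section Multiplier

variable {V : Type*} [NormedAddCommGroup V] [InnerProductSpace ℝ V] [FiniteDimensional ℝ V]
  [MeasurableSpace V] [BorelSpace V]

/-- `u ∈ L²` lies in the (maximal) domain of the Fourier multiplier with symbol `m`, that is
`m · 𝓕 u ∈ L²`. -/
def InMultiplierDomain (m : V → ℝ) (u : L2 V) : Prop :=
  MemLp (fun ξ => (m ξ : ℂ) * (𝓕 u : L2 V) ξ) 2 volume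

/-- The Fourier multiplier with symbol `m`: `𝓕 (M u) = m · 𝓕 u` for `u` in its domain
(and `0` for `u` outside). -/
def fourierMultiplier (m : V → ℝ) (u : L2 V) : L2 V :=
  open Classical in
  if h : InMultiplierDomain m u then 𝓕⁻ (h.toLp (fun ξ => (m ξ : ℂ) * (𝓕 u : L2 V) ξ)) else 0

theorem fourier_fourierMultiplier {m : V → ℝ} {u : L2 V} (h : InMultiplierDomain m u) :
    (𝓕 (fourierMultiplier m u) : L2 V) =ᵐ[volume] fun ξ => (m ξ : ℂ) * (𝓕 u : L2 V) ξ := by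
  rw [fourierMultiplier, dif_pos h, FourierTransform.fourier_fourierInv_eq]
  exact h.coeFn_toLp

end Multiplier

/-- The domain of the unbounded operator `J₀` on `L²(ℝ)`, `𝓕 (J₀ u)(τ) = |τ|^{1/2} 𝓕 u(τ)`. -/
def InDomJ0 (u : L2 ℝ) : Prop := InMultiplierDomain (fun τ : ℝ => |τ| ^ (1 / 2 : ℝ)) u

/-- The operator `J₀`, `𝓕 (J₀ u)(τ) = |τ|^{1/2} 𝓕 u(τ)`. -/
def J0 (u : L2 ℝ) : L2 ℝ := fourierMultiplier (fun τ : ℝ => |τ| ^ (1 / 2 : ℝ)) u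

/-! ### Wavelet, shearlet and Radon transforms -/

/-- `W_{b,a} χ(t) = |a|^{-1/2} χ((t - b) / a)`. -/
def wavelet (χ : ℝ → ℂ) (b a : ℝ) : ℝ → ℂ :=
  fun t => ((|a| ^ (-1 / 2 : ℝ) : ℝ) : ℂ) * χ ((t - b) / a)

/-- The wavelet transform `⟨u, W_{b,a} χ⟩`. -/
def waveletTransform (χ u : ℝ → ℂ) (b a : ℝ) : ℂ := pairing u (wavelet χ b a)

/-- The action of a `2 × 2` matrix on the plane. -/
def act (M : Matrix (Fin 2) (Fin 2) ℝ) (x : Plane) : Plane := WithLp.toLp 2 (M *ᵥ x.ofLp)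

/-- The shearing matrix `N_s`. -/
def shearH (s : ℝ) : Matrix (Fin 2) (Fin 2) ℝ := !![1, -s; 0, 1]

/-- The parabolic dilation matrix `A_a`. -/
def dilH (a : ℝ) : Matrix (Fin 2) (Fin 2) ℝ := a • !![1, 0; 0, |a| ^ (-1 / 2 : ℝ)]

/-- The vertical shearing matrix. -/
def shearV (s : ℝ) : Matrix (Fin 2) (Fin 2) ℝ := !![1, 0; -s, 1]

/-- The vertical parabolic dilation matrix. -/
def dilV (a : ℝ) : Matrix (Fin 2) (Fin 2) ℝ := a • !![|a| ^ (-1 / 2 : ℝ), 0; 0, 1]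

/-- `S_{b,s,a} ψ(x) = |a|^{-3/4} ψ(A_a⁻¹ N_s⁻¹ (x - b))`. -/
def shearletH (ψ : Plane → ℂ) (b : Plane) (s a : ℝ) : Plane → ℂ :=
  fun x => ((|a| ^ (-3 / 4 : ℝ) : ℝ) : ℂ) * ψ (act ((dilH a)⁻¹ * (shearH s)⁻¹) (x - b))

/-- The vertical analogue of `shearletH`. -/
def shearletV (ψ : Plane → ℂ) (b : Plane) (s a : ℝ) : Plane → ℂ :=
  fun x => ((|a| ^ (-3 / 4 : ℝ) : ℝ) : ℂ) * ψ (act ((dilV a)⁻¹ * (shearV s)⁻¹) (x - b))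

/-- The shearlet transform `⟨f, S_{b,s,a} ψ⟩`. -/
def shearletTransformH (ψ f : Plane → ℂ) (b : Plane) (s a : ℝ) : ℂ :=
  pairing f (shearletH ψ b s a)

/-- The vertical shearlet transform. -/
def shearletTransformV (ψ f : Plane → ℂ) (b : Plane) (s a : ℝ) : ℂ :=
  pairing f (shearletV ψ b s a)

/-- The horizontal affine Radon transform, over the lines `x + v y = t`. -/
def radonH (f : Plane → ℂ) (v t : ℝ) : ℂ := ∫ y : ℝ, f !₂[t - v * y, y]

/-- The vertical affine Radon transform, over the lines `v x + y = t`. -/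
def radonV (f : Plane → ℂ) (v t : ℝ) : ℂ := ∫ x : ℝ, f !₂[x, t - v * x]

/-- The interchange of the two coordinates. -/
def swapCoords : Plane ≃ₗᵢ[ℝ] Plane :=
  LinearIsometryEquiv.piLpCongrLeft 2 ℝ ℝ (Equiv.swap (0 : Fin 2) 1)

/-- `ψ^v`, given by `𝓕 ψ^v(ξ₁, ξ₂) = 𝓕 ψ(ξ₂, ξ₁)`. -/
def vert (ψ : L2 Plane) : L2 Plane :=
  𝓕⁻ (Lp.compMeasurePreserving swapCoords swapCoords.measurePreserving (𝓕 ψ : L2 Plane))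

/-- The admissibility constant `C_ψ = ∫ |𝓕 ψ(ξ)|² / |ξ₁|² dξ`. -/
def admissibilityConst (ψ : L2 Plane) : ℝ≥0∞ :=
  ∫⁻ ξ : Plane, ‖(𝓕 ψ : L2 Plane) ξ‖ₑ ^ 2 / ‖ξ 0‖ₑ ^ 2

/-- The standing assumptions on the shearlet `ψ` and its factors `ψ₁`, `ψ₂`. -/
structure IsSeparableShearlet (ψ : L2 Plane) (ψ₁ ψ₂ : L2 ℝ) : Prop where
  admissible : admissibilityConst ψ = 1
  factor : ∀ᵐ ξ : Plane, (𝓕 ψ : L2 Plane) ξ = (𝓕 ψ₁ : L2 ℝ) (ξ 0) * (𝓕 ψ₂ : L2 ℝ) (ξ 1 / ξ 0)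
  calderon_pos : 0 < ∫⁻ τ : ℝ, ‖(𝓕 ψ₁ : L2 ℝ) τ‖ₑ ^ 2 / ‖τ‖ₑ
  calderon_lt_top : ∫⁻ τ : ℝ, ‖(𝓕 ψ₁ : L2 ℝ) τ‖ₑ ^ 2 / ‖τ‖ₑ < ⊤
  moment_one : ∫⁻ τ : ℝ, ‖τ‖ₑ * ‖(𝓕 ψ₁ : L2 ℝ) τ‖ₑ ^ 2 < ⊤
  moment_two : ∫⁻ τ : ℝ, ‖τ‖ₑ ^ 2 * ‖(𝓕 ψ₁ : L2 ℝ) τ‖ₑ ^ 2 < ⊤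

/-- `χ₁`, given by `𝓕 χ₁(τ) = |τ| 𝓕 ψ₁(τ)`. -/
def chi1 (ψ₁ : L2 ℝ) : L2 ℝ := fourierMultiplier (fun τ : ℝ => |τ|) ψ₁

/-- `ψ₁` is in the domain of the multiplier that defines `χ₁`. -/
theorem IsSeparableShearlet.inMultiplierDomain {ψ : L2 Plane} {ψ₁ ψ₂ : L2 ℝ}
    (h : IsSeparableShearlet ψ ψ₁ ψ₂) : InMultiplierDomain (fun τ : ℝ => |τ|) ψ₁ := by
  refine ⟨AEStronglyMeasurable.mul ?_ (Lp.aestronglyMeasurable _), ?_⟩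
  · exact (Complex.continuous_ofReal.comp continuous_abs).aestronglyMeasurable
  · rw [eLpNorm_lt_top_iff_lintegral_rpow_enorm_lt_top (by norm_num) (by norm_num)]
    refine lt_of_eq_of_lt (lintegral_congr fun τ => ?_) h.moment_two
    have h1 : ‖((|τ| : ℝ) : ℂ)‖ₑ = ‖τ‖ₑ := by
      rw [← ofReal_norm, ← ofReal_norm, Complex.norm_real, norm_abs_eq_norm]
    rw [enorm_mul, h1, ENNReal.toReal_ofNat, ENNReal.rpow_ofNat, mul_pow]

/-! ### Smooth angular localization -/

/-- The part of the circle `(-π, π]` around the horizontal axis. -/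
def coverH (ε : ℝ) : Set ℝ :=
  Ioo (-Real.pi) (-(3 / 4) * Real.pi + ε) ∪ Ioo (-(Real.pi / 4) - ε) (Real.pi / 4 + ε)
    ∪ Ioc (3 / 4 * Real.pi - ε) Real.pi

/-- The part of the circle `(-π, π]` around the vertical axis. -/
def coverV (ε : ℝ) : Set ℝ :=
  Ioo (-(3 / 4) * Real.pi - ε) (-(Real.pi / 4) + ε)
    ∪ Ioo (Real.pi / 4 - ε) (3 / 4 * Real.pi + ε)

/-- A smooth partition `φ² + φ^v² = 1` of the circle subordinate to the cover
`{coverH ε, coverV ε}`. Smooth functions on the circle are smooth `2π`-periodic functions of the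
angle; a function on the circle is even if it takes the same value at antipodal points. -/
structure IsAngularPartition (ε : ℝ) (φ φv : ℝ → ℝ) : Prop where
  smoothH : ContDiff ℝ ∞ φ
  smoothV : ContDiff ℝ ∞ φv
  periodicH : Function.Periodic φ (2 * Real.pi)
  periodicV : Function.Periodic φv (2 * Real.pi)
  evenH : ∀ θ, φ (θ + Real.pi) = φ θ
  evenV : ∀ θ, φv (θ + Real.pi) = φv θ
  suppH : tsupport φ ∩ Ioc (-Real.pi) Real.pi ⊆ coverH ε
  suppV : tsupport φv ∩ Ioc (-Real.pi) Real.pi ⊆ coverV ε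
  sq_add_sq : ∀ θ, φ θ ^ 2 + φv θ ^ 2 = 1

/-- `Φ(ξ) = φ(θ_ξ)`, where `θ_ξ ∈ (-π, π]` is the polar angle of `ξ ≠ 0`. -/
def angular (φ : ℝ → ℝ) (ξ : Plane) : ℝ := φ (Complex.arg ⟨ξ 0, ξ 1⟩)

/-- The localization operator `𝓕 (L f) = Φ · 𝓕 f`. -/
def localize (φ : ℝ → ℝ) (f : L2 Plane) : L2 Plane := fourierMultiplier (angular φ) f

/-- The localization operators are defined on all of `L²`. -/
theorem inMultiplierDomain_angular {φ : ℝ → ℝ} (hφ : Continuous φ) (hb : ∀ θ, φ θ ^ 2 ≤ 1)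
    (f : L2 Plane) : InMultiplierDomain (angular φ) f := by
  refine (Lp.memLp (𝓕 f : L2 Plane)).of_le ?_ (Filter.Eventually.of_forall fun ξ => ?_)
  · refine AEStronglyMeasurable.mul ?_ (Lp.aestronglyMeasurable _)
    apply Measurable.aestronglyMeasurable
    refine Complex.measurable_ofReal.comp (hφ.measurable.comp (Complex.measurable_arg.comp ?_))
    exact Complex.measurableEquivRealProd.symm.measurable.comp
      (Measurable.prodMk (by fun_prop) (by fun_prop) : Measurable fun ξ : Plane => (ξ 0, ξ 1))
  · rw [norm_mul, Complex.norm_real, Real.norm_eq_abs]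
    exact mul_le_of_le_one_left (norm_nonneg _) ((sq_le_one_iff_abs_le_one _).1 (hb _))

/-- The condition that couples the window `g` with `ψ` and the angular partition. Integrals of
nonnegative functions take values in `[0, ∞]`. -/
def WindowCondition (φ φv : ℝ → ℝ) (ψ : L2 Plane) (g : Plane → ℂ) : Prop :=
  ∀ᵐ ξ : Plane,
    ‖𝓕 g ξ‖ₑ ^ 2
      + ENNReal.ofReal (angular φ ξ ^ 2) *
          (∫⁻ a in Icc (-1 : ℝ) 1, (∫⁻ s in Icc (-2 : ℝ) 2,
            ‖(𝓕 ψ : L2 Plane) (act (dilH a * (shearH s)ᵀ) ξ)‖ₑ ^ 2) / ‖a‖ₑ ^ (3 / 2 : ℝ))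
      + ENNReal.ofReal (angular φv ξ ^ 2) *
          (∫⁻ a in Icc (-1 : ℝ) 1, (∫⁻ s in Icc (-2 : ℝ) 2,
            ‖(𝓕 (vert ψ) : L2 Plane) (act (dilV a * shearH s) ξ)‖ₑ ^ 2) / ‖a‖ₑ ^ (3 / 2 : ℝ))
      = 1

end ConeShearlet

end

noncomputable section

namespace ConeShearlet

/-! All coefficients are read off on the Fourier side. Pairing an `L²` function with a translate by
`b` of an affinely deformed `L²` function gives `∫ ξ, echar (inner ℝ b ξ) * G ξ`, where `G` is a
product of two `L²` functions, hence integrable, and does not depend on `b`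
(`IsTransposePair.pairing_eq`). This is `𝓕 G` at `-b`, so Plancherel in `b` (`lintegral_echar_sq`)
turns each energy into an integral of `|𝓕 f|²` against a weight. After Tonelli
(`lintegral_scale_swap`) the weights are the three summands of the window condition; they add up to
`1`, which is the norm identity.

The Radon formulas come from the coordinates `ξ = (τ, τ v)`, with Jacobian `|τ|` (`map_cone`). By
the slice theorem (`fourier_radonH`), `𝓕 f` on the line of slope `v` is the Fourier transform of the
Radon slice at `v`. There the angular cut-off depends on `v` alone (`angular_cone`), and the dilated
shearlet splits into a function of `a τ` times a function of `v`
(`IsSeparableShearlet.ae_shearletFourier`). The inner integral over `τ` is then a one-dimensional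
coefficient. The Jacobian goes into `χ₁` for shearlets; for the window it is split as `|τ|^{1/2}
|τ|^{1/2}` between two copies of `J₀`, or put entirely on the slice of `g`.

Interchanging the coordinates commutes with the Fourier transform and reduces the vertical case to
the horizontal one, with the reflected cut-off `φ (π/2 - θ)` (`shearletTransformV_vert`,
`swapL2_localize`). -/

/-- The character `t ↦ exp (2πi t)`. -/
def echar (t : ℝ) : ℂ := (Real.fourierChar t : Circle)

theorem norm_echar (t : ℝ) : ‖echar t‖ = 1 := Circle.norm_coe _

theorem echar_add (s t : ℝ) : echar (s + t) = echar s * echar t := by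
  simp [echar, AddChar.map_add_eq_mul]

theorem conj_echar (t : ℝ) : conj (echar t) = echar (-t) := by
  rw [echar, echar, AddChar.map_neg_eq_inv, Circle.coe_inv_eq_conj]

theorem continuous_echar : Continuous echar :=
  continuous_subtype_val.comp Real.continuous_fourierChar

/-! ### The Fourier transform on `L²`: duality and affine changes of variable -/

section FourierL2

variable {V : Type*} [NormedAddCommGroup V] [InnerProductSpace ℝ V] [FiniteDimensional ℝ V]
  [MeasurableSpace V] [BorelSpace V]

-- The `L²` transform is compatible with the transform of tempered distributions, which is defined
-- by this duality.
open SchwartzMap in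
theorem integral_mul_fourier_schwartz (u : L2 V) (h : 𝓢(V, ℂ)) :
    ∫ x, 𝓕 (h : V → ℂ) x * u x = ∫ x, h x * (𝓕 u : L2 V) x := by
  have h1 := congrArg (fun T : 𝓢'(V, ℂ) => T h) (Lp.fourier_toTemperedDistribution_eq u)
  simpa [TemperedDistribution.fourier_apply, Lp.toTemperedDistribution_apply,
    SchwartzMap.fourier_coe] using h1

/-- The bilinear pairing `∫ u w` on `L²`. -/
def bilinPairing : L2 V →L[ℂ] L2 V →L[ℂ] ℂ :=
  (ContinuousLinearMap.mul ℂ ℂ).lpPairing volume 2 2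

theorem bilinPairing_apply (u w : L2 V) : bilinPairing u w = ∫ x, u x * w x := by
  simp [bilinPairing, ContinuousLinearMap.lpPairing_eq_integral]

/-- The multiplication formula for the Fourier transform on `L²`. -/
theorem integral_fourier_mul (w u : L2 V) :
    ∫ x, (𝓕 w : L2 V) x * u x = ∫ x, w x * (𝓕 u : L2 V) x := by
  rw [← bilinPairing_apply, ← bilinPairing_apply]
  -- Both sides are continuous in `w`, so it is enough to treat Schwartz functions, which are dense.
  refine DenseRange.induction_on (p := fun w : L2 V => bilinPairing (𝓕 w) u = bilinPairing w (𝓕 u))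
    (SchwartzMap.denseRange_toLpCLM (p := 2) ENNReal.ofNat_ne_top) w ?_ ?_
  · apply isClosed_eq
    · exact (bilinPairing.flip u).continuous.comp (Lp.fourierTransformₗᵢ V ℂ).continuous
    · exact (bilinPairing.flip (𝓕 u)).continuous
  · intro h
    simp only [SchwartzMap.toLpCLM_apply, SchwartzMap.toLp_fourier_eq, bilinPairing_apply]
    rw [integral_congr_ae (g := fun x => 𝓕 (h : V → ℂ) x * u x),
      integral_mul_fourier_schwartz]
    · apply integral_congr_ae
      filter_upwards [h.coeFn_toLp 2 (volume : Measure V)] with x hx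
      rw [hx]
    · filter_upwards [(𝓕 h).coeFn_toLp 2 (volume : Measure V)] with x hx
      rw [hx, SchwartzMap.fourier_coe]

/-- The multiplication formula for the Fourier transform on `L¹`. -/
theorem integral_fourier_mul_of_integrable {h u : V → ℂ} (hh : Integrable h) (hu : Integrable u) :
    ∫ x, 𝓕 h x * u x = ∫ x, h x * 𝓕 u x := by
  have := VectorFourier.integral_fourierIntegral_smul_eq_flip (L := innerₗ V)
    (μ := volume) (ν := volume) Real.continuous_fourierChar continuous_inner hh hu
  simp only [smul_eq_mul, flip_innerₗ] at this
  exact this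

/-- Smooth compactly supported functions separate locally integrable functions, and each of them is
Schwartz. Compact support is handed on to the test function because it makes modulated and linearly
transformed copies integrable at once. -/
theorem ae_eq_of_integral_schwartz {u w : V → ℂ} (hu : LocallyIntegrable u)
    (hw : LocallyIntegrable w)
    (h : ∀ h : SchwartzMap V ℂ, HasCompactSupport h → ∫ x, h x * u x = ∫ x, h x * w x) :
    u =ᵐ[volume] w := by
  refine ae_eq_of_integral_contDiff_smul_eq hu hw fun k hk hkc => ?_
  have h1 : HasCompactSupport (Complex.ofRealCLM ∘ k) := hkc.comp_left rfl
  have h2 : ContDiff ℝ ∞ (Complex.ofRealCLM ∘ k) := by fun_prop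
  simpa using h (h1.toSchwartzMap h2) h1

theorem continuous_fourier_of_integrable {u : V → ℂ} (hu : Integrable u) : Continuous (𝓕 u) :=
  VectorFourier.fourierIntegral_continuous Real.continuous_fourierChar continuous_inner hu

/-- On `L¹ ∩ L²` the two definitions of the Fourier transform agree. -/
theorem fourier_toLp_ae_eq {u : V → ℂ} (h1 : Integrable u) (h2 : MemLp u 2) :
    (𝓕 (h2.toLp u) : L2 V) =ᵐ[volume] 𝓕 u := by
  refine ae_eq_of_integral_schwartz ((Lp.memLp _).locallyIntegrable one_le_two)
    (continuous_fourier_of_integrable h1).locallyIntegrable fun h _ => ?_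
  rw [← integral_mul_fourier_schwartz, ← integral_fourier_mul_of_integrable h.integrable h1]
  apply integral_congr_ae
  filter_upwards [h2.coeFn_toLp] with x hx
  rw [hx]

/-- The `L²` inverse transform of `𝓕 u` and `u` itself have the same integrals against Schwartz
functions, so they coincide. This converse to Plancherel gives square-integrability of functions
known only through their transform. -/
theorem memLp_two_of_memLp_fourier {u : V → ℂ} (h1 : Integrable u) (h2 : MemLp (𝓕 u) 2) :
    MemLp u 2 := by
  set w : L2 V := 𝓕⁻ (h2.toLp (𝓕 u)) with hw
  refine (memLp_congr_ae ?_).1 (Lp.memLp w)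
  refine ae_eq_of_integral_schwartz ((Lp.memLp _).locallyIntegrable one_le_two)
    h1.locallyIntegrable fun h _ => ?_
  have e : (h : V → ℂ) = 𝓕 ((𝓕⁻ h : SchwartzMap V ℂ) : V → ℂ) := by
    rw [← SchwartzMap.fourier_coe, FourierTransform.fourier_fourierInv_eq]
  rw [e, integral_mul_fourier_schwartz,
    integral_fourier_mul_of_integrable (SchwartzMap.integrable _) h1, hw,
    FourierTransform.fourier_fourierInv_eq]
  apply integral_congr_ae
  filter_upwards [h2.coeFn_toLp] with x hx
  rw [hx]

theorem memLp_comp_of_map_eq {A : V → V} (hA : MeasurableEmbedding A) {c : ℝ}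
    (hc : Measure.map A (volume : Measure V) = ENNReal.ofReal c • volume) {k : V → ℂ}
    {p : ℝ≥0∞} (hk : MemLp k p) : MemLp (fun x => k (A x)) p := by
  have : MemLp k p (Measure.map A (volume : Measure V)) := by
    rw [hc]; exact hk.smul_measure ENNReal.ofReal_ne_top
  exact (memLp_map_measure_iff this.1 hA.measurable.aemeasurable).1 this

theorem integral_comp_of_map_eq {A : V → V} (hA : MeasurableEmbedding A) {c : ℝ} (h0 : 0 ≤ c)
    (hc : Measure.map A (volume : Measure V) = ENNReal.ofReal c • volume) (k : V → ℂ) :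
    ∫ x, k (A x) = c * ∫ x, k x := by
  rw [← hA.integral_map, hc, integral_smul_measure, ENNReal.toReal_ofReal h0, Complex.real_smul]

theorem quasiMeasurePreserving_of_map_eq {A : V → V} (hA : Measurable A) {c : ℝ}
    (hc : Measure.map A (volume : Measure V) = ENNReal.ofReal c • volume) :
    Measure.QuasiMeasurePreserving A volume volume :=
  ⟨hA, by rw [hc]; exact Measure.smul_absolutelyContinuous⟩

/-- The Fourier transform of `x ↦ k (A (x - b))` in `L²`, where `B` is the transpose of `A`. -/
theorem fourier_comp_affine (A B : V ≃L[ℝ] V) {c : ℝ} (hc : 0 < c)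
    (hAB : ∀ x y : V, inner ℝ (B x) y = inner ℝ x (A y))
    (hA : Measure.map A (volume : Measure V) = ENNReal.ofReal c • volume)
    (hB : Measure.map B (volume : Measure V) = ENNReal.ofReal c • volume)
    (hB' : Measure.map B.symm (volume : Measure V) = ENNReal.ofReal c⁻¹ • volume)
    (k : L2 V) (b : V) (w : L2 V) (hw : w =ᵐ[volume] fun x => k (A (x - b))) :
    (𝓕 w : L2 V) =ᵐ[volume] fun ξ => (c : ℂ) * echar (-inner ℝ b ξ)
        * (𝓕 k : L2 V) (B.symm ξ) := by
  have h0 := hc.le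
  have hc' : (c : ℂ) ≠ 0 := by exact_mod_cast hc.ne'
  have mA : MeasurableEmbedding (A : V → V) := A.toHomeomorph.measurableEmbedding
  have mB : MeasurableEmbedding (B : V → V) := B.toHomeomorph.measurableEmbedding
  have mB' : MeasurableEmbedding (B.symm : V → V) := B.symm.toHomeomorph.measurableEmbedding
  have hcont : Continuous fun ξ : V => echar (-inner ℝ b ξ) := by
    exact continuous_echar.comp (by fun_prop)
  have m1 : MemLp (fun ξ => (𝓕 k : L2 V) (B.symm ξ)) 2 volume :=
    memLp_comp_of_map_eq mB' hB' (Lp.memLp _)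
  have m2 : MemLp (fun ξ => (c : ℂ) * echar (-inner ℝ b ξ)
        * (𝓕 k : L2 V) (B.symm ξ)) 2 volume := by
    simp only [mul_assoc]
    refine MemLp.const_mul (m1.of_le ?_ ?_) _
    · exact hcont.aestronglyMeasurable.mul m1.1
    · exact Filter.Eventually.of_forall fun ξ => by
        rw [norm_mul, norm_echar, one_mul]
  refine ae_eq_of_integral_schwartz ((Lp.memLp _).locallyIntegrable one_le_two)
    (m2.locallyIntegrable one_le_two) fun h hh => ?_
  rw [← integral_mul_fourier_schwartz]
  -- The modulated test function pulled back through `B`: its transform along `A` is a translate of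
  -- `𝓕 h`, up to the factor `c`, because `⟨B η, x⟩ = ⟨η, A x⟩`.
  set h' : V → ℂ := fun η => echar (-inner ℝ b (B η)) * h (B η) with hh'
  have ch' : Continuous h' := (hcont.comp B.continuous).mul (h.continuous.comp B.continuous)
  have sh' : HasCompactSupport h' :=
    (hh.comp_homeomorph B.toHomeomorph).mul_left
  have i1 : Integrable h' := ch'.integrable_of_hasCompactSupport sh'
  have i2 : MemLp h' 2 := ch'.memLp_of_hasCompactSupport sh'
  have key : ∀ x, 𝓕 h' (A x) = c * 𝓕 (h : V → ℂ) (x + b) := by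
    intro x
    rw [Real.fourier_eq, Real.fourier_eq, ← integral_comp_of_map_eq mB h0 hB]
    refine integral_congr_ae (Filter.Eventually.of_forall fun η => ?_)
    simp only [hh', Circle.smul_def, smul_eq_mul]
    change echar _ * _ = echar _ * _
    rw [← mul_assoc, ← echar_add, ← hAB, inner_add_right, real_inner_comm b]
    congr 2
    exact (neg_add _ _).symm
  calc ∫ x, 𝓕 (h : V → ℂ) x * w x = ∫ x, 𝓕 (h : V → ℂ) x * k (A (x - b)) := by
        apply integral_congr_ae
        filter_upwards [hw] with x hx
        rw [hx]
    _ = ∫ x, 𝓕 (h : V → ℂ) (x + b) * k (A x) := by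
        rw [← integral_add_right_eq_self _ b]
        simp
    _ = ∫ x, (c : ℂ)⁻¹ * (𝓕 h' (A x) * k (A x)) := by
        refine integral_congr_ae (Filter.Eventually.of_forall fun x => ?_)
        simp only [key]
        rw [mul_assoc, inv_mul_cancel_left₀ hc']
    _ = (c : ℂ)⁻¹ * (c * ∫ y, 𝓕 h' y * k y) := by
        rw [integral_const_mul]
        congr 1
        exact integral_comp_of_map_eq mA h0 hA (fun y => 𝓕 h' y * k y)
    _ = (c : ℂ)⁻¹ * (c * ∫ y, h' y * (𝓕 k : L2 V) y) := by
        congr 2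
        have := integral_fourier_mul (i2.toLp h') k
        rw [integral_congr_ae (g := fun x => 𝓕 h' x * k x),
          integral_congr_ae (f := fun x => i2.toLp h' x * (𝓕 k : L2 V) x)
            (g := fun x => h' x * (𝓕 k : L2 V) x)] at this
        · exact this
        · filter_upwards [i2.coeFn_toLp] with x hx
          rw [hx]
        · filter_upwards [fourier_toLp_ae_eq i1 i2] with x hx
          rw [hx]
    _ = (c : ℂ)⁻¹ * (c * (∫ y, (fun ξ => echar (-inner ℝ b ξ) * h ξ *
          (𝓕 k : L2 V) (B.symm ξ)) (B y))) := by
        simp [hh']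
    _ = _ := by
        rw [integral_comp_of_map_eq mB h0 hB (fun ξ => echar (-inner ℝ b ξ) *
          h ξ * (𝓕 k : L2 V) (B.symm ξ)), inv_mul_cancel_left₀ hc', ← integral_const_mul]
        refine integral_congr_ae (Filter.Eventually.of_forall fun ξ => ?_)
        simp only
        ring

end FourierL2

/-! ### Affine coefficients and Plancherel's identity -/

section FourierCoefficients

variable {V : Type*} [NormedAddCommGroup V] [InnerProductSpace ℝ V] [FiniteDimensional ℝ V]
  [MeasurableSpace V] [BorelSpace V]

theorem pairing_congr {X : Type*} [MeasureSpace X] {f f' h h' : X → ℂ}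
    (hf : f =ᵐ[volume] f') (hh : h =ᵐ[volume] h') : pairing f h = pairing f' h' := by
  apply integral_congr_ae
  filter_upwards [hf, hh] with x h1 h2
  rw [h1, h2]

theorem parseval (f k : L2 V) :
    pairing (f : V → ℂ) k = pairing (𝓕 f : L2 V) (𝓕 k : L2 V) := by
  have h : ∀ f k : L2 V, pairing (f : V → ℂ) k = inner ℂ k f := by
    intro f k
    rw [L2.inner_def]
    simp [pairing]
  rw [h, h, Lp.inner_fourier_eq]

theorem integrable_mul_conj {u w : V → ℂ} (hu : MemLp u 2) (hw : MemLp w 2) :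
    Integrable (fun x => u x * conj (w x)) :=
  hu.integrable_mul hw.star

theorem enorm_conj (z : ℂ) : ‖conj z‖ₑ = ‖z‖ₑ := by
  rw [← ofReal_norm, ← ofReal_norm, RCLike.norm_conj]

/-- A pair of mutually transposed linear isomorphisms that scale the volume by `c⁻¹`. -/
structure IsTransposePair (A B : V ≃L[ℝ] V) (c : ℝ) : Prop where
  pos : 0 < c
  transpose : ∀ x y : V, inner ℝ (B x) y = inner ℝ x (A y)
  map_left : Measure.map A (volume : Measure V) = ENNReal.ofReal c • volume
  map_right : Measure.map B (volume : Measure V) = ENNReal.ofReal c • volume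
  map_symm : Measure.map B.symm (volume : Measure V) = ENNReal.ofReal c⁻¹ • volume

theorem isTransposePair_refl :
    IsTransposePair (ContinuousLinearEquiv.refl ℝ V) (ContinuousLinearEquiv.refl ℝ V) 1 := by
  refine ⟨one_pos, fun _ _ => rfl, ?_, ?_, ?_⟩ <;> simp

section

variable {A B : V ≃L[ℝ] V} {c : ℝ} (h : IsTransposePair A B c)

include h

theorem IsTransposePair.memLp_fourier (k : L2 V) :
    MemLp (fun ξ => (c : ℂ) * (𝓕 k : L2 V) (B.symm ξ)) 2 :=
  (memLp_comp_of_map_eq B.symm.toHomeomorph.measurableEmbedding h.map_symm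
    (Lp.memLp (𝓕 k : L2 V))).const_mul _

theorem IsTransposePair.integrable (f k : L2 V) :
    Integrable fun ξ => (𝓕 f : L2 V) ξ * conj ((c : ℂ) * (𝓕 k : L2 V) (B.symm ξ)) :=
  integrable_mul_conj (Lp.memLp _) (h.memLp_fourier k)

/-- Affine coefficients on the Fourier side. -/
theorem IsTransposePair.pairing_eq (f k : L2 V) (b : V) {w : V → ℂ}
    (hw : w =ᵐ[volume] fun x => k (A (x - b))) :
    pairing f w = ∫ ξ, echar (inner ℝ b ξ) *
      ((𝓕 f : L2 V) ξ * conj ((c : ℂ) * (𝓕 k : L2 V) (B.symm ξ))) := by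
  have hk : MemLp (fun x => k (A (x - b))) 2 := by
    have : MemLp (fun x => k (A x)) 2 := memLp_comp_of_map_eq
      A.toHomeomorph.measurableEmbedding h.map_left (Lp.memLp k)
    exact this.comp_measurePreserving (measurePreserving_sub_right volume b)
  rw [pairing_congr (Filter.EventuallyEq.refl _ _) (hw.trans hk.coeFn_toLp.symm), parseval]
  have := fourier_comp_affine A B h.pos h.transpose h.map_left h.map_right h.map_symm k b _
    hk.coeFn_toLp
  apply integral_congr_ae
  filter_upwards [this] with ξ hξ
  rw [hξ]
  simp only [map_mul, conj_echar, neg_neg]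
  ring

end

theorem eLpNorm_two_sq {X : Type*} [MeasurableSpace X] {μ : Measure X} {u : X → ℂ} :
    eLpNorm u 2 μ ^ 2 = ∫⁻ x, ‖u x‖ₑ ^ 2 ∂μ := by
  have := eLpNorm_nnreal_pow_eq_lintegral (μ := μ) (f := u) (p := 2) two_ne_zero
  simpa using this

/-- Plancherel's identity for integrable functions, with values in `[0, ∞]`. -/
theorem lintegral_fourier_sq {G : V → ℂ} (hG : Integrable G) :
    ∫⁻ b, ‖𝓕 G b‖ₑ ^ 2 = ∫⁻ ξ, ‖G ξ‖ₑ ^ 2 := by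
  rw [← eLpNorm_two_sq, ← eLpNorm_two_sq]
  by_cases h : MemLp G 2
  · rw [← eLpNorm_congr_ae (fourier_toLp_ae_eq hG h), ← eLpNorm_congr_ae h.coeFn_toLp]
    have := congrArg ENNReal.ofReal (Lp.norm_fourier_eq (h.toLp G))
    rw [ofReal_norm, ofReal_norm, Lp.enorm_def, Lp.enorm_def] at this
    rw [this]
  -- If `G` is not square-integrable, neither is `𝓕 G`, and both sides are infinite.
  · have h' : ¬ MemLp (𝓕 G) 2 := fun h' => h (memLp_two_of_memLp_fourier hG h')
    have e1 : eLpNorm G 2 volume = ⊤ := by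
      by_contra h0
      exact h ⟨hG.1, lt_top_iff_ne_top.2 h0⟩
    have e2 : eLpNorm (𝓕 G) 2 volume = ⊤ := by
      by_contra h0
      exact h' ⟨(continuous_fourier_of_integrable hG).aestronglyMeasurable,
        lt_top_iff_ne_top.2 h0⟩
    rw [e1, e2]

/-- The inner integral is `𝓕 G` at `-b`, and Lebesgue measure is invariant under reflection. -/
theorem lintegral_echar_sq {G : V → ℂ} (hG : Integrable G) :
    ∫⁻ b, ‖∫ ξ, echar (inner ℝ b ξ) * G ξ‖ₑ ^ 2 = ∫⁻ ξ, ‖G ξ‖ₑ ^ 2 := by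
  rw [← lintegral_fourier_sq hG,
    ← (Measure.measurePreserving_neg (volume : Measure V)).lintegral_comp_emb
      (MeasurableEquiv.neg V).measurableEmbedding]
  refine lintegral_congr fun b => ?_
  rw [Real.fourier_eq]
  congr 2
  refine integral_congr_ae (Filter.Eventually.of_forall fun ξ => ?_)
  simp only [echar, Circle.smul_def, smul_eq_mul, inner_neg_left, real_inner_comm b]

end FourierCoefficients

/-! ### Slope coordinates on the frequency plane -/

section ConeCoordinates

theorem measurePreserving_mkPlane :
    MeasurePreserving (fun p : ℝ × ℝ => (!₂[p.1, p.2] : Plane)) volume volume :=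
  (PiLp.volume_preserving_toLp (Fin 2)).comp (volume_preserving_finTwoArrow ℝ).symm

/-- The coordinates `(v, τ) ↦ (τ, τ v)` on the plane. -/
def cone (p : ℝ × ℝ) : Plane := !₂[p.2, p.2 * p.1]

theorem measurable_cone : Measurable cone :=
  measurePreserving_mkPlane.measurable.comp
    (f := fun p : ℝ × ℝ => (p.2, p.2 * p.1)) (by fun_prop)

/-- For fixed `τ ≠ 0` the substitution `ξ₂ = τ v` has Jacobian `|τ|`, and the line `τ = 0` is null.
-/
theorem lintegral_cone {H : Plane → ℝ≥0∞} (hH : Measurable H) :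
    ∫⁻ ξ, H ξ = ∫⁻ v : ℝ, ∫⁻ τ : ℝ, ‖τ‖ₑ * H (cone (v, τ)) := by
  have m1 : Measurable fun p : ℝ × ℝ => H !₂[p.1, p.2] :=
    hH.comp measurePreserving_mkPlane.measurable
  have m2 : Measurable fun p : ℝ × ℝ => ‖p.2‖ₑ * H (cone p) :=
    (measurable_snd.enorm).mul (hH.comp measurable_cone)
  rw [← measurePreserving_mkPlane.lintegral_comp hH, Measure.volume_eq_prod,
    lintegral_prod _ m1.aemeasurable,
    lintegral_lintegral_swap (f := fun v τ => ‖τ‖ₑ * H (cone (v, τ))) m2.aemeasurable]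
  have h0 : ∀ᵐ τ : ℝ, τ ≠ 0 := Measure.ae_ne volume 0
  refine lintegral_congr_ae ?_
  filter_upwards [h0] with τ hτ
  rw [lintegral_const_mul]
  · have h1 := Real.smul_map_volume_mul_left hτ
    have m3 : Measurable fun y : ℝ => H !₂[τ, y] := m1.comp measurable_prodMk_left
    conv_lhs => rw [← h1]
    rw [lintegral_smul_measure, lintegral_map m3 (measurable_const_mul τ)]
    rw [smul_eq_mul, ← Real.norm_eq_abs, ofReal_norm]
    rfl
  · exact hH.comp (measurable_cone.comp measurable_prodMk_right)

/-- Obtained by testing `lintegral_cone` on indicators; in this form the change of variables also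
transfers null sets and Bochner integrals. -/
theorem map_cone :
    Measure.map cone ((volume : Measure (ℝ × ℝ)).withDensity fun p => (‖p.2‖₊ : ℝ≥0∞)) = volume := by
  ext s hs
  have hm : Measurable fun p : ℝ × ℝ => (‖p.2‖₊ : ℝ≥0∞) := by fun_prop
  rw [Measure.map_apply measurable_cone hs, ← lintegral_indicator_one hs,
    ← lintegral_indicator_one (measurable_cone hs),
    lintegral_withDensity_eq_lintegral_mul _ hm
      (measurable_one.indicator (measurable_cone hs)),
    lintegral_cone (measurable_one.indicator hs), Measure.volume_eq_prod, lintegral_prod]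
  · rfl
  · exact (hm.mul (measurable_one.indicator (measurable_cone hs))).aemeasurable

/-- The density `|τ|` vanishes only on the null line `τ = 0`, so null sets of the plane pull back to
null sets, which Fubini then slices. -/
theorem ae_cone {P : Plane → Prop} (h : ∀ᵐ ξ, P ξ) : ∀ᵐ v : ℝ, ∀ᵐ τ : ℝ, P (cone (v, τ)) := by
  rw [← map_cone] at h
  have h1 := ae_of_ae_map measurable_cone.aemeasurable h
  rw [ae_withDensity_iff (by fun_prop), Measure.volume_eq_prod] at h1
  filter_upwards [Measure.ae_ae_of_ae_prod h1] with v hv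
  filter_upwards [hv, Measure.ae_ne volume 0] with τ hτ h0
  exact hτ (by simpa using h0)

theorem integrable_cone {H : Plane → ℂ} (hH : Integrable H) :
    Integrable (fun p : ℝ × ℝ => ((|p.2| : ℝ) : ℂ) * H (cone p)) (volume.prod volume) := by
  rw [← map_cone] at hH
  have h1 := (integrable_map_measure hH.1 measurable_cone.aemeasurable).1 hH
  rw [integrable_withDensity_iff_integrable_smul (by fun_prop)] at h1
  exact h1

theorem integral_cone {H : Plane → ℂ} (hH : Integrable H) :
    ∫ ξ, H ξ = ∫ v : ℝ, ∫ τ : ℝ, ((|τ| : ℝ) : ℂ) * H (cone (v, τ)) := by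
  rw [← integral_prod _ (integrable_cone hH)]
  conv_lhs => rw [← map_cone]
  rw [← map_cone] at hH
  rw [integral_map measurable_cone.aemeasurable hH.1,
    integral_withDensity_eq_integral_smul (by fun_prop)]
  rfl

end ConeCoordinates

/-! ### Radon slices and the Fourier slice theorem -/

section Radon

/-- The parametrization of the plane by the lines `x + v y = t`. -/
def lineH (v : ℝ) (p : ℝ × ℝ) : Plane := !₂[p.1 - v * p.2, p.2]

/-- For fixed `y` the first coordinate is merely translated, so this is a skew product of
measure-preserving maps. -/
theorem measurePreserving_lineH (v : ℝ) : MeasurePreserving (lineH v) volume volume := by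
  have h1 : MeasurePreserving (fun p : ℝ × ℝ => (p.1, p.2 - v * p.1))
      (volume.prod volume) (volume.prod volume) :=
    (MeasurePreserving.id volume).skew_product (g := fun y t => t - v * y)
      (by fun_prop) (Filter.Eventually.of_forall fun y =>
        (measurePreserving_sub_right volume (v * y)).map_eq)
  exact (measurePreserving_mkPlane.comp Measure.measurePreserving_swap).comp
    (h1.comp Measure.measurePreserving_swap)

theorem integrable_lineH {f : Plane → ℂ} (hf : Integrable f) (v : ℝ) :
    Integrable (fun p => f (lineH v p)) (volume.prod volume) :=
  (measurePreserving_lineH v).integrable_comp_of_integrable hf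

theorem integrable_radonH {f : Plane → ℂ} (hf : Integrable f) (v : ℝ) :
    Integrable (radonH f v) :=
  (integrable_lineH hf v).integral_prod_left

/-- The Fourier slice theorem. -/
theorem fourier_radonH {f : Plane → ℂ} (hf : Integrable f) (v τ : ℝ) :
    𝓕 (radonH f v) τ = 𝓕 f (cone (v, τ)) := by
  have h0 : 𝓕 f (cone (v, τ)) = ∫ x, echar (-inner ℝ x (cone (v, τ))) * f x := by
    rw [Real.fourier_eq]
    simp only [echar, Circle.smul_def, smul_eq_mul]
  have hc : Continuous fun x : Plane => echar (-inner ℝ x (cone (v, τ))) :=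
    continuous_echar.comp (by fun_prop)
  have hi : Integrable fun x => echar (-inner ℝ x (cone (v, τ))) * f x :=
    hf.bdd_mul hc.aestronglyMeasurable
      (Filter.Eventually.of_forall fun x => (norm_echar _).le)
  rw [h0, Real.fourier_real_eq]
  have h1 := (measurePreserving_lineH v).map_eq
  conv_rhs => rw [← h1]
  rw [integral_map (measurePreserving_lineH v).aemeasurable (by rw [h1]; exact hi.1),
    Measure.volume_eq_prod, integral_prod _ (integrable_lineH hi v)]
  refine integral_congr_ae (Filter.Eventually.of_forall fun t => ?_)
  simp only [Circle.smul_def, smul_eq_mul]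
  rw [radonH, ← integral_const_mul]
  refine integral_congr_ae (Filter.Eventually.of_forall fun y => ?_)
  simp only [echar, lineH, cone, PiLp.inner_apply, Fin.sum_univ_two]
  congr 3
  simp
  ring

theorem memLp_two_iff_lintegral {X : Type*} [MeasurableSpace X] {μ : Measure X} {u : X → ℂ}
    (hu : AEStronglyMeasurable u μ) : MemLp u 2 μ ↔ ∫⁻ x, ‖u x‖ₑ ^ 2 ∂μ < ⊤ := by
  rw [← eLpNorm_two_sq, ENNReal.pow_lt_top_iff]
  simp [MemLp, hu]

/-- A bounded function `u` with `|τ|^{1/2} u ∈ L²` lies in `L²`. -/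
theorem memLp_two_of_weighted {u : ℝ → ℂ} (hu : AEStronglyMeasurable u) {M : ℝ≥0∞} (hM : M ≠ ⊤)
    (hb : ∀ τ, ‖u τ‖ₑ ≤ M) (h : ∫⁻ τ, ‖τ‖ₑ * ‖u τ‖ₑ ^ 2 < ⊤) : MemLp u 2 := by
  rw [memLp_two_iff_lintegral hu]
  have hm : Measurable ((Icc (-1 : ℝ) 1).indicator fun _ => M ^ 2) :=
    measurable_const.indicator measurableSet_Icc
  -- On `|τ| ≤ 1` the constant bound has finite integral; outside, the weight is at least `1`.
  calc ∫⁻ τ, ‖u τ‖ₑ ^ 2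
      ≤ ∫⁻ τ, ((Icc (-1 : ℝ) 1).indicator (fun _ => M ^ 2) τ + ‖τ‖ₑ * ‖u τ‖ₑ ^ 2) := by
        refine lintegral_mono fun τ => ?_
        by_cases hτ : τ ∈ Icc (-1 : ℝ) 1
        · rw [indicator_of_mem hτ]
          exact le_add_right (pow_le_pow_left' (hb τ) 2)
        · refine le_add_left (le_mul_of_one_le_left' ?_)
          rw [← ofReal_norm, ← ENNReal.ofReal_one]
          apply ENNReal.ofReal_le_ofReal
          rw [Real.norm_eq_abs]
          by_contra! h
          exact hτ (abs_le.1 h.le)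
    _ < ⊤ := by
        rw [lintegral_add_left hm, lintegral_indicator measurableSet_Icc]
        refine ENNReal.add_lt_top.2 ⟨?_, h⟩
        simp only [lintegral_const, Measure.restrict_apply_univ]
        exact ENNReal.mul_lt_top (ENNReal.pow_lt_top hM.lt_top) measure_Icc_lt_top

theorem toL2_coeFn {u : ℝ → ℂ} (h : MemLp u 2) : (toL2 u : ℝ → ℂ) =ᵐ[volume] u := by
  rw [toL2, dif_pos h]
  exact h.coeFn_toLp

theorem fourier_toL2 {u : ℝ → ℂ} (h1 : Integrable u) (h : MemLp u 2) :
    (𝓕 (toL2 u) : L2 ℝ) =ᵐ[volume] 𝓕 u := by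
  rw [toL2, dif_pos h]
  exact fourier_toLp_ae_eq h1 h

theorem enorm_abs_rpow_half_sq (τ : ℝ) : ‖((|τ| ^ (1 / 2 : ℝ) : ℝ) : ℂ)‖ₑ ^ 2 = ‖τ‖ₑ := by
  rw [← ofReal_norm, Complex.norm_real, Real.norm_of_nonneg (by positivity),
    ← ENNReal.ofReal_pow (by positivity), ← Real.rpow_natCast, ← Real.rpow_mul (abs_nonneg _)]
  simp [← ofReal_norm]

/-- Almost every Radon slice is square-integrable, in the domain of `J₀`, and satisfies the
Fourier slice theorem in `L²`. -/
theorem ae_radonH {f : Plane → ℂ} (hf₁ : MemLp f 1) (hf₂ : MemLp f 2) :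
    ∀ᵐ v : ℝ, MemLp (radonH f v) 2 ∧
      ((𝓕 (toL2 (radonH f v)) : L2 ℝ) =ᵐ[volume] fun τ => 𝓕 f (cone (v, τ))) ∧
      InDomJ0 (toL2 (radonH f v)) := by
  have hi : Integrable f := memLp_one_iff_integrable.1 hf₁
  have hcont := continuous_fourier_of_integrable hi
  have hm : Measurable fun ξ : Plane => ‖𝓕 f ξ‖ₑ ^ 2 := by
    exact hcont.measurable.enorm.pow_const 2
  have hfin : ∫⁻ ξ, ‖𝓕 f ξ‖ₑ ^ 2 < ⊤ := by
    rw [lintegral_fourier_sq hi, ← memLp_two_iff_lintegral hf₂.1]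
    exact hf₂
  -- The finite energy of `f` becomes an iterated integral, so its inner weighted integral is finite
  -- for almost every `v`. That finiteness gives both the `L²` property of the slice and membership
  -- in the domain of `J₀`.
  rw [lintegral_cone hm] at hfin
  have hmm : Measurable fun p : ℝ × ℝ => ‖p.2‖ₑ * ‖𝓕 f (cone p)‖ₑ ^ 2 :=
    measurable_snd.enorm.mul (hm.comp measurable_cone)
  filter_upwards [ae_lt_top hmm.lintegral_prod_right' hfin.ne] with v hv
  have hslice : 𝓕 (radonH f v) = fun τ => 𝓕 f (cone (v, τ)) := funext fun τ => fourier_radonH hi v τ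
  have hri := integrable_radonH hi v
  have hs : AEStronglyMeasurable fun τ => 𝓕 f (cone (v, τ)) := by
    rw [← hslice]
    exact (continuous_fourier_of_integrable hri).aestronglyMeasurable
  have h2 : MemLp (radonH f v) 2 := by
    apply memLp_two_of_memLp_fourier hri
    rw [hslice]
    -- The uniform bound on `𝓕 f` is the `L¹` norm of `f`.
    refine memLp_two_of_weighted hs (M := ENNReal.ofReal (∫ x, ‖f x‖)) ENNReal.ofReal_ne_top
      (fun τ => ?_) hv
    rw [← ofReal_norm]
    exact ENNReal.ofReal_le_ofReal
      (VectorFourier.norm_fourierIntegral_le_integral_norm _ _ _ _ _)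
  have h3 : (𝓕 (toL2 (radonH f v)) : L2 ℝ) =ᵐ[volume] fun τ => 𝓕 f (cone (v, τ)) := by
    rw [← hslice]
    exact fourier_toL2 hri h2
  refine ⟨h2, h3, ?_⟩
  have hw : Continuous fun τ : ℝ => ((|τ| ^ (1 / 2 : ℝ) : ℝ) : ℂ) :=
    Complex.continuous_ofReal.comp
      (continuous_abs.rpow_const fun _ => Or.inr (by norm_num))
  refine (memLp_two_iff_lintegral
    (hw.aestronglyMeasurable.mul (Lp.aestronglyMeasurable _))).2 ?_
  refine lt_of_eq_of_lt (lintegral_congr_ae ?_) hv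
  filter_upwards [h3] with τ hτ
  rw [Pi.mul_apply, hτ, enorm_mul, mul_pow, enorm_abs_rpow_half_sq]

end Radon

/-! ### Wavelet coefficients in frequency -/

section Wavelet

theorem isTransposePair_div {a : ℝ} (ha : a ≠ 0) :
    IsTransposePair (ContinuousLinearEquiv.smulLeft (Units.mk0 a ha)⁻¹ : ℝ ≃L[ℝ] ℝ)
      (ContinuousLinearEquiv.smulLeft (Units.mk0 a ha)⁻¹) |a| := by
  have h1 := Real.map_volume_mul_left (inv_ne_zero ha)
  rw [inv_inv] at h1
  have h2 := Real.map_volume_mul_left ha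
  refine ⟨abs_pos.2 ha, fun x y => ?_, h1, h1, ?_⟩
  · change y * (a⁻¹ * x) = (a⁻¹ * y) * x
    ring
  · rw [← abs_inv]
    exact h2

theorem pairing_const_mul {X : Type*} [MeasureSpace X] (f h : X → ℂ) (c : ℂ) :
    pairing f (fun x => c * h x) = conj c * pairing f h := by
  rw [pairing, pairing, ← integral_const_mul]
  refine integral_congr_ae (Filter.Eventually.of_forall fun x => ?_)
  simp only [map_mul]
  ring

/-- The weight `|a|^{1/2}` is the normalisation `|a|^{-1/2}` times the Jacobian `|a|` of the
dilation. -/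
theorem waveletTransform_eq (u χ : L2 ℝ) (b : ℝ) {a : ℝ} (ha : a ≠ 0) :
    waveletTransform χ u b a = ∫ τ : ℝ, echar (b * τ) *
      ((𝓕 u : L2 ℝ) τ * conj (((|a| ^ (1 / 2 : ℝ) : ℝ) : ℂ) * (𝓕 χ : L2 ℝ) (a * τ))) := by
  have := (isTransposePair_div ha).pairing_eq u χ b (w := fun t => χ ((t - b) / a))
    (Filter.Eventually.of_forall fun t => by
      change χ ((t - b) / a) = χ (a⁻¹ * (t - b))
      rw [div_eq_inv_mul])
  rw [waveletTransform]
  unfold wavelet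
  rw [pairing_const_mul, this, ← integral_const_mul]
  refine integral_congr_ae (Filter.Eventually.of_forall fun τ => ?_)
  have e : (|a| ^ (1 / 2 : ℝ) : ℝ) = |a| ^ (-1 / 2 : ℝ) * |a| := by
    rw [← Real.rpow_add_one (abs_pos.2 ha).ne']
    norm_num
  change _ * (echar (τ * b) * (_ * conj (_ * (𝓕 χ : L2 ℝ) (a * τ)))) = _
  rw [e, mul_comm τ b]
  simp only [map_mul, Complex.conj_ofReal, Complex.ofReal_mul]
  ring

/-- Nonzero dilations pull null sets back to null sets, so the almost-everywhere description of `𝓕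
χ₁` may be evaluated at `a * τ`. -/
theorem InMultiplierDomain.fourier_chi1 {ψ₁ : L2 ℝ}
    (h : InMultiplierDomain (fun τ : ℝ => |τ|) ψ₁) {a : ℝ} (ha : a ≠ 0) :
    ∀ᵐ τ : ℝ, (𝓕 (chi1 ψ₁) : L2 ℝ) (a * τ) = ((|a * τ| : ℝ) : ℂ) * (𝓕 ψ₁ : L2 ℝ) (a * τ) :=
  (quasiMeasurePreserving_of_map_eq (measurable_const_mul a) (Real.map_volume_mul_left ha)).ae
    (fourier_fourierMultiplier h)

end Wavelet

/-! ### Invertible matrices acting on the plane -/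

section MatrixAction

theorem act_mul (M N : Matrix (Fin 2) (Fin 2) ℝ) (x : Plane) : act (M * N) x = act M (act N x) := by
  simp only [act, Matrix.mulVec_mulVec]

/-- The action of an invertible matrix on the plane. -/
def actEquiv (M : Matrix (Fin 2) (Fin 2) ℝ) (hM : IsUnit M.det) : Plane ≃L[ℝ] Plane :=
  LinearEquiv.toContinuousLinearEquiv
    { toFun := act M
      invFun := act M⁻¹
      map_add' := fun x y => by
        rw [act, WithLp.ofLp_add, Matrix.mulVec_add, WithLp.toLp_add]; rfl
      map_smul' := fun c x => by
        rw [act, WithLp.ofLp_smul, Matrix.mulVec_smul, WithLp.toLp_smul]; rfl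
      left_inv := fun x => by rw [← act_mul, Matrix.nonsing_inv_mul _ hM]; simp [act]
      right_inv := fun x => by rw [← act_mul, Matrix.mul_nonsing_inv _ hM]; simp [act] }

theorem map_act {M : Matrix (Fin 2) (Fin 2) ℝ} (hM : M.det ≠ 0) :
    Measure.map (act M) volume = ENNReal.ofReal |M.det|⁻¹ • volume := by
  have h1 := Real.map_matrix_volume_pi_eq_smul_volume_pi hM
  have e : act M = WithLp.toLp 2 ∘ Matrix.toLin' M ∘ WithLp.ofLp := by
    ext x
    simp [act]
  have m1 : Measurable (Matrix.toLin' M) := (Matrix.toLin' M).continuous_of_finiteDimensional.measurable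
  rw [e, ← Measure.map_map (PiLp.volume_preserving_toLp (Fin 2)).measurable
      (m1.comp (PiLp.volume_preserving_ofLp (Fin 2)).measurable),
    ← Measure.map_map m1 (PiLp.volume_preserving_ofLp (Fin 2)).measurable,
    (PiLp.volume_preserving_ofLp (Fin 2)).map_eq, h1, Measure.map_smul,
    (PiLp.volume_preserving_toLp (Fin 2)).map_eq, abs_inv]

theorem inner_act_transpose (M : Matrix (Fin 2) (Fin 2) ℝ) (x y : Plane) :
    inner ℝ (act Mᵀ x) y = inner ℝ x (act M y) := by
  simp [act, PiLp.inner_apply, Fin.sum_univ_two]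
  ring

theorem isTransposePair_act {M : Matrix (Fin 2) (Fin 2) ℝ} (hM : IsUnit M.det) :
    IsTransposePair (actEquiv M hM) (actEquiv Mᵀ (by rwa [Matrix.det_transpose])) |M.det|⁻¹ := by
  have h0 := hM.ne_zero
  have ht : Mᵀ.det ≠ 0 := by rwa [Matrix.det_transpose]
  refine ⟨inv_pos.2 (abs_pos.2 h0), inner_act_transpose M, map_act h0, ?_, ?_⟩
  · have := map_act ht
    rwa [Matrix.det_transpose] at this
  · have h1 : (Mᵀ⁻¹).det ≠ 0 := by
      rw [Matrix.det_nonsing_inv, Ring.inverse_eq_inv']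
      exact inv_ne_zero ht
    have := map_act h1
    rwa [Matrix.det_nonsing_inv, Ring.inverse_eq_inv', Matrix.det_transpose, abs_inv] at this

theorem det_shearH (s : ℝ) : (shearH s).det = 1 := by simp [shearH]

theorem det_dilH {a : ℝ} (ha : a ≠ 0) : (dilH a).det = |a| ^ (3 / 2 : ℝ) := by
  have h : (3 / 2 : ℝ) = -1 / 2 + 2 := by norm_num
  rw [h, Real.rpow_add (abs_pos.2 ha), dilH, Matrix.det_smul]
  simp [mul_comm]

end MatrixAction

/-! ### Horizontal shearlet coefficients -/

section Horizontal

theorem inv_abs_det_inv {a : ℝ} (ha : a ≠ 0) (s : ℝ) :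
    |((dilH a)⁻¹ * (shearH s)⁻¹).det|⁻¹ = |a| ^ (3 / 2 : ℝ) := by
  rw [Matrix.det_mul, Matrix.det_nonsing_inv, Matrix.det_nonsing_inv, det_shearH, det_dilH ha,
    Ring.inverse_one, mul_one, Ring.inverse_eq_inv', abs_inv, inv_inv,
    abs_of_nonneg (by positivity)]

theorem isUnit_det_inv {a : ℝ} (ha : a ≠ 0) (s : ℝ) :
    IsUnit ((dilH a)⁻¹ * (shearH s)⁻¹).det := by
  rw [isUnit_iff_ne_zero]
  intro h
  have := inv_abs_det_inv ha s
  rw [h, abs_zero, inv_zero] at this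
  exact (Real.rpow_pos_of_pos (abs_pos.2 ha) _).ne this

/-- The dilation is diagonal, hence symmetric; only the shear keeps its transpose. -/
theorem inv_transpose_inv {a : ℝ} (ha : a ≠ 0) (s : ℝ) :
    (((dilH a)⁻¹ * (shearH s)⁻¹)ᵀ)⁻¹ = dilH a * (shearH s)ᵀ := by
  rw [← Matrix.mul_inv_rev, ← Matrix.transpose_nonsing_inv, Matrix.nonsing_inv_nonsing_inv,
    Matrix.transpose_mul]
  · congr 1
    ext i j
    fin_cases i <;> fin_cases j <;> simp [dilH]
  · rw [Matrix.det_mul, det_shearH, det_dilH ha, one_mul, isUnit_iff_ne_zero]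
    exact (Real.rpow_pos_of_pos (abs_pos.2 ha) _).ne'

/-- The dilated and sheared shearlet in the frequency domain. -/
def shearletFourier (ψ : L2 Plane) (s a : ℝ) (ξ : Plane) : ℂ :=
  ((|a| ^ (3 / 4 : ℝ) : ℝ) : ℂ) * (𝓕 ψ : L2 Plane) (act (dilH a * (shearH s)ᵀ) ξ)

theorem exists_isTransposePair_shearlet {a : ℝ} (ha : a ≠ 0) (s : ℝ) :
    ∃ A B : Plane ≃L[ℝ] Plane, IsTransposePair A B (|a| ^ (3 / 2 : ℝ)) ∧
      (∀ x, A x = act ((dilH a)⁻¹ * (shearH s)⁻¹) x) ∧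
      ∀ x, B.symm x = act (dilH a * (shearH s)ᵀ) x := by
  have h := isTransposePair_act (isUnit_det_inv ha s)
  rw [inv_abs_det_inv ha s] at h
  refine ⟨_, _, h, fun x => rfl, fun x => ?_⟩
  change act _ x = _
  rw [inv_transpose_inv ha s]

/-- The shearlet normalisation times the Jacobian of the affine map gives the frequency-side weight.
-/
theorem rpow_three_quarters {a : ℝ} (ha : a ≠ 0) :
    (|a| ^ (3 / 4 : ℝ) : ℝ) = |a| ^ (-3 / 4 : ℝ) * |a| ^ (3 / 2 : ℝ) := by
  rw [← Real.rpow_add (abs_pos.2 ha)]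
  norm_num

theorem integrable_shearletFourier (ψ F : L2 Plane) (s : ℝ) {a : ℝ} (ha : a ≠ 0) :
    Integrable fun ξ => (𝓕 F : L2 Plane) ξ * conj (shearletFourier ψ s a ξ) := by
  obtain ⟨A, B, h, hA, hB⟩ := exists_isTransposePair_shearlet ha s
  refine ((h.integrable F ψ).const_mul ((|a| ^ (-3 / 4 : ℝ) : ℝ) : ℂ)).congr
    (Filter.Eventually.of_forall fun ξ => ?_)
  simp only [shearletFourier, rpow_three_quarters ha, hB, map_mul, Complex.conj_ofReal,
    Complex.ofReal_mul]
  ring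

theorem shearletTransformH_eq (ψ F : L2 Plane) (b : Plane) (s : ℝ) {a : ℝ} (ha : a ≠ 0) :
    shearletTransformH ψ F b s a = ∫ ξ, echar (inner ℝ b ξ) *
      ((𝓕 F : L2 Plane) ξ * conj (shearletFourier ψ s a ξ)) := by
  obtain ⟨A, B, h, hA, hB⟩ := exists_isTransposePair_shearlet ha s
  have := h.pairing_eq F ψ b (w := fun x => ψ (act ((dilH a)⁻¹ * (shearH s)⁻¹) (x - b)))
    (Filter.Eventually.of_forall fun x => by simp only [hA])
  rw [shearletTransformH]
  unfold shearletH
  rw [pairing_const_mul, this, ← integral_const_mul]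
  refine integral_congr_ae (Filter.Eventually.of_forall fun ξ => ?_)
  simp only [shearletFourier, rpow_three_quarters ha, hB, map_mul, Complex.conj_ofReal,
    Complex.ofReal_mul]
  ring

theorem lintegral_shearletTransformH_sq (ψ F : L2 Plane) (s : ℝ) {a : ℝ} (ha : a ≠ 0) :
    ∫⁻ b, ‖shearletTransformH ψ F b s a‖ₑ ^ 2 = ∫⁻ ξ, ‖(𝓕 F : L2 Plane) ξ‖ₑ ^ 2 *
      (‖a‖ₑ ^ (3 / 2 : ℝ) * ‖(𝓕 ψ : L2 Plane) (act (dilH a * (shearH s)ᵀ) ξ)‖ₑ ^ 2) := by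
  rw [lintegral_congr fun b => by rw [shearletTransformH_eq ψ F b s ha],
    lintegral_echar_sq (integrable_shearletFourier ψ F s ha)]
  have e : ‖((|a| ^ (3 / 4 : ℝ) : ℝ) : ℂ)‖ₑ ^ 2 = ‖a‖ₑ ^ (3 / 2 : ℝ) := by
    rw [← ofReal_norm, Complex.norm_real, Real.norm_of_nonneg (by positivity),
      ← ENNReal.ofReal_pow (by positivity), ← Real.rpow_natCast, ← Real.rpow_mul (abs_nonneg _),
      ← ofReal_norm, Real.norm_eq_abs, ENNReal.ofReal_rpow_of_pos (abs_pos.2 ha)]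
    norm_num
  refine lintegral_congr fun ξ => ?_
  rw [enorm_mul, enorm_conj, shearletFourier, enorm_mul, mul_pow, mul_pow, e]

/-- Points of slope `v` with `τ` of opposite signs have angles differing by `π`, which evenness of
`φ` on the circle does not see. -/
theorem angular_cone {φ : ℝ → ℝ} (he : ∀ θ, φ (θ + Real.pi) = φ θ) {v τ : ℝ} (hτ : τ ≠ 0) :
    angular φ (cone (v, τ)) = φ (Real.arctan v) := by
  have hp : Function.Periodic φ Real.pi := he
  have h2 : Function.Periodic φ (2 * Real.pi) := by
    simpa using hp.nat_mul 2
  have hw : Complex.arg ⟨1, v⟩ = Real.arctan v := by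
    have h1 : |Complex.arg ⟨1, v⟩| < Real.pi / 2 :=
      Complex.abs_arg_lt_pi_div_two_iff.2 (Or.inl one_pos)
    rw [← Real.arctan_tan (neg_lt_of_abs_lt h1) (lt_of_abs_lt h1), Complex.tan_arg]
    simp
  have hne : (⟨1, v⟩ : ℂ) ≠ 0 := fun h => one_ne_zero (congrArg Complex.re h)
  have e : (⟨cone (v, τ) 0, cone (v, τ) 1⟩ : ℂ) = (τ : ℂ) * ⟨1, v⟩ := by
    apply Complex.ext <;> simp [cone]
  rw [angular, e]
  rcases lt_or_gt_of_ne hτ with h | h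
  · have e2 : (τ : ℂ) * ⟨1, v⟩ = ((-τ : ℝ) : ℂ) * -⟨1, v⟩ := by push_cast; ring
    rw [e2, Complex.arg_real_mul _ (neg_pos.2 h)]
    have h3 := Complex.arg_neg_coe_angle hne
    rw [← Real.Angle.coe_add, Real.Angle.angle_eq_iff_two_pi_dvd_sub] at h3
    obtain ⟨k, hk⟩ := h3
    have h4 : Complex.arg (-⟨1, v⟩) = Real.arctan v + Real.pi + k * (2 * Real.pi) := by
      rw [← hw]; linarith
    rw [h4, h2.int_mul k, he]
  · rw [Complex.arg_real_mul _ h, hw]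

theorem fourier_localize {φ : ℝ → ℝ} (hφ : Continuous φ) (hb : ∀ θ, φ θ ^ 2 ≤ 1) (F : L2 Plane) :
    (𝓕 (localize φ F) : L2 Plane) =ᵐ[volume] fun ξ => (angular φ ξ : ℂ) * (𝓕 F : L2 Plane) ξ :=
  fourier_fourierMultiplier (inMultiplierDomain_angular hφ hb F)

theorem quasiMeasurePreserving_act_dilH_shearH {a : ℝ} (ha : a ≠ 0) (s : ℝ) :
    Measure.QuasiMeasurePreserving (act (dilH a * (shearH s)ᵀ)) volume volume := by
  obtain ⟨A, B, h, hA, hB⟩ := exists_isTransposePair_shearlet ha s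
  have e : act (dilH a * (shearH s)ᵀ) = B.symm := funext fun x => (hB x).symm
  rw [e]
  exact quasiMeasurePreserving_of_map_eq B.symm.continuous.measurable h.map_symm

theorem transpose_shearH (s : ℝ) : (shearH s)ᵀ = shearV s := by
  ext i j
  fin_cases i <;> fin_cases j <;> simp [shearH, shearV]

/-- For `a τ ≠ 0` the quotient of the two entries is `(v - s) / |a|^{1/2}`, free of `τ`; this
decouples the two factors of a separable shearlet. -/
theorem act_cone (a s v τ : ℝ) : act (dilH a * (shearH s)ᵀ) (cone (v, τ)) =
    !₂[a * τ, a * |a| ^ (-1 / 2 : ℝ) * (τ * (v - s))] := by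
  rw [transpose_shearH]
  ext i
  fin_cases i <;> simp [act, cone, dilH, shearV] <;> ring

theorem IsSeparableShearlet.ae_shearletFourier {ψ : L2 Plane} {ψ₁ ψ₂ : L2 ℝ}
    (hψ : IsSeparableShearlet ψ ψ₁ ψ₂) (s : ℝ) {a : ℝ} (ha : a ≠ 0) :
    ∀ᵐ v : ℝ, ∀ᵐ τ : ℝ, shearletFourier ψ s a (cone (v, τ)) =
      ((|a| ^ (3 / 4 : ℝ) : ℝ) : ℂ) * ((𝓕 ψ₁ : L2 ℝ) (a * τ)
        * (𝓕 ψ₂ : L2 ℝ) ((v - s) / |a| ^ (1 / 2 : ℝ))) := by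
  filter_upwards [ae_cone ((quasiMeasurePreserving_act_dilH_shearH ha s).ae hψ.factor)] with v hv
  filter_upwards [hv, Measure.ae_ne volume 0] with τ hτ h0
  rw [shearletFourier, hτ, act_cone]
  have e : a * |a| ^ (-1 / 2 : ℝ) * (τ * (v - s)) / (a * τ) = (v - s) / |a| ^ (1 / 2 : ℝ) := by
    have : |a| ^ (-1 / 2 : ℝ) = (|a| ^ (1 / 2 : ℝ))⁻¹ := by
      rw [← Real.rpow_neg (abs_nonneg _)]
      norm_num
    rw [this]
    field_simp
  simp only [Matrix.cons_val_zero, Matrix.cons_val_one, e]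

/-- Horizontal shearlet coefficients through the wavelet transform of the Radon transform. -/
theorem shearletTransformH_localize {φ : ℝ → ℝ} (hφ : Continuous φ) (hb : ∀ θ, φ θ ^ 2 ≤ 1)
    (he : ∀ θ, φ (θ + Real.pi) = φ θ) {ψ : L2 Plane} {ψ₁ ψ₂ : L2 ℝ}
    (hψ : IsSeparableShearlet ψ ψ₁ ψ₂) {f : Plane → ℂ} (hf₁ : MemLp f 1) (hf₂ : MemLp f 2)
    (x y s : ℝ) {a : ℝ} (ha : a ≠ 0) :
    Integrable (fun v : ℝ => waveletTransform (chi1 ψ₁) (radonH f v) (x + v * y) a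
      * conj ((𝓕 ψ₂ : L2 ℝ) ((v - s) / |a| ^ (1 / 2 : ℝ))) * (φ (Real.arctan v) : ℂ)) volume
    ∧ shearletTransformH ψ (localize φ (hf₂.toLp f)) !₂[x, y] s a
      = ((|a| ^ (-3 / 4 : ℝ) : ℝ) : ℂ) *
        ∫ v : ℝ, waveletTransform (chi1 ψ₁) (radonH f v) (x + v * y) a
          * conj ((𝓕 ψ₂ : L2 ℝ) ((v - s) / |a| ^ (1 / 2 : ℝ))) * (φ (Real.arctan v) : ℂ) := by
  set F := localize φ (hf₂.toLp f) with hF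
  set W : ℝ → ℂ := fun v => waveletTransform (chi1 ψ₁) (radonH f v) (x + v * y) a
      * conj ((𝓕 ψ₂ : L2 ℝ) ((v - s) / |a| ^ (1 / 2 : ℝ))) * (φ (Real.arctan v) : ℂ) with hWdef
  set H : Plane → ℂ := fun ξ => echar (inner ℝ !₂[x, y] ξ) *
      ((𝓕 F : L2 Plane) ξ * conj (shearletFourier ψ s a ξ)) with hH
  have hc : Continuous fun ξ : Plane => echar (inner ℝ !₂[x, y] ξ) :=
    continuous_echar.comp (by fun_prop)
  have hi : Integrable H := (integrable_shearletFourier ψ F s ha).bdd_mul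
    hc.aestronglyMeasurable (Filter.Eventually.of_forall fun ξ => (norm_echar _).le)
  have hFf : ∀ᵐ ξ, (𝓕 F : L2 Plane) ξ = (angular φ ξ : ℂ) * 𝓕 f ξ := by
    filter_upwards [fourier_localize hφ hb (hf₂.toLp f),
      fourier_toLp_ae_eq (memLp_one_iff_integrable.1 hf₁) hf₂] with ξ h1 h2
    rw [hF, h1, h2]
  have hchi := hψ.inMultiplierDomain.fourier_chi1 ha
  have key : ∀ᵐ v : ℝ, ∫ τ : ℝ, ((|τ| : ℝ) : ℂ) * H (cone (v, τ)) =
      ((|a| ^ (-3 / 4 : ℝ) : ℝ) : ℂ) * W v := by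
    filter_upwards [ae_cone hFf, hψ.ae_shearletFourier s ha, ae_radonH hf₁ hf₂] with v h1 h2 h3
    have h4 : waveletTransform (chi1 ψ₁) (radonH f v) (x + v * y) a =
        waveletTransform (chi1 ψ₁) (toL2 (radonH f v)) (x + v * y) a :=
      pairing_congr (toL2_coeFn h3.1).symm (Filter.EventuallyEq.refl _ _)
    -- The three factors are the prefactor of the formula, the weight of the wavelet coefficient,
    -- and the part of `|a * τ|` that comes from `χ₁`.
    have e : ((|a| ^ (3 / 4 : ℝ) : ℝ) : ℂ) =
        ((|a| ^ (-3 / 4 : ℝ) : ℝ) : ℂ) * ((|a| ^ (1 / 2 : ℝ) : ℝ) : ℂ) * ((|a| : ℝ) : ℂ) := by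
      rw [← Complex.ofReal_mul, ← Complex.ofReal_mul, ← Real.rpow_add (abs_pos.2 ha),
        ← Real.rpow_add_one (abs_pos.2 ha).ne']
      norm_num
    rw [hWdef]
    simp only []
    rw [h4, waveletTransform_eq _ _ _ ha, mul_assoc, ← integral_mul_const, ← integral_const_mul]
    apply integral_congr_ae
    filter_upwards [h1, h2, h3.2.1, hchi, Measure.ae_ne volume 0] with τ t1 t2 t3 t4 t5
    have e2 : inner ℝ !₂[x, y] (cone (v, τ)) = (x + v * y) * τ := by
      simp [cone, PiLp.inner_apply, Fin.sum_univ_two]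
      ring
    simp only [hH]
    rw [t1, t2, t3, t4, e2, angular_cone he t5, e, abs_mul]
    simp only [map_mul, Complex.conj_ofReal, Complex.ofReal_mul]
    ring
  have ha' : ((|a| ^ (-3 / 4 : ℝ) : ℝ) : ℂ) ≠ 0 := by
    exact_mod_cast (Real.rpow_pos_of_pos (abs_pos.2 ha) _).ne'
  refine ⟨?_, ?_⟩
  -- Fubini in slope coordinates gives integrability in `v`; the nonzero prefactor is then divided
  -- out.
  · refine (((integrable_cone hi).integral_prod_left.congr key).const_mul
      ((|a| ^ (-3 / 4 : ℝ) : ℝ) : ℂ)⁻¹).congr (Filter.Eventually.of_forall fun v => ?_)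
    simp only []
    rw [inv_mul_cancel_left₀ ha']
  · rw [shearletTransformH_eq ψ F _ s ha, ← integral_const_mul, ← integral_congr_ae key,
      ← integral_cone hi]

end Horizontal

/-! ### Window coefficients and `J₀` -/

section Window

theorem pairing_translate_eq {V : Type*} [NormedAddCommGroup V] [InnerProductSpace ℝ V]
    [FiniteDimensional ℝ V] [MeasurableSpace V] [BorelSpace V] (f k : L2 V) (b : V) :
    pairing f (translate b k) = ∫ ξ, echar (inner ℝ b ξ) *
      ((𝓕 f : L2 V) ξ * conj ((𝓕 k : L2 V) ξ)) := by
  have := isTransposePair_refl.pairing_eq f k b (w := translate b k) (Filter.EventuallyEq.refl _ _)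
  simpa using this

theorem translate_congr {V : Type*} [NormedAddCommGroup V] [InnerProductSpace ℝ V]
    [FiniteDimensional ℝ V] [MeasurableSpace V] [BorelSpace V] {k k' : V → ℂ} (b : V)
    (h : k =ᵐ[volume] k') : translate b k =ᵐ[volume] translate b k' :=
  (measurePreserving_sub_right volume b).quasiMeasurePreserving.ae_eq_comp h

theorem abs_rpow_half_mul_self (τ : ℝ) :
    ((|τ| ^ (1 / 2 : ℝ) : ℝ) : ℂ) * ((|τ| ^ (1 / 2 : ℝ) : ℝ) : ℂ) = ((|τ| : ℝ) : ℂ) := by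
  rw [← Complex.ofReal_mul, ← Real.sqrt_eq_rpow, Real.mul_self_sqrt (abs_nonneg _)]

variable {f g : Plane → ℂ} (hf₁ : MemLp f 1) (hf₂ : MemLp f 2) (hg₁ : MemLp g 1) (hg₂ : MemLp g 2)

include hf₁ hf₂ hg₁ hg₂

theorem integrable_fourier_mul_conj : Integrable fun ξ => 𝓕 f ξ * conj (𝓕 g ξ) := by
  have h1 := fourier_toLp_ae_eq (memLp_one_iff_integrable.1 hf₁) hf₂
  have h2 := fourier_toLp_ae_eq (memLp_one_iff_integrable.1 hg₁) hg₂
  exact integrable_mul_conj ((memLp_congr_ae h1).1 (Lp.memLp _)) ((memLp_congr_ae h2).1 (Lp.memLp _))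

theorem windowCoefficient_eq (b : Plane) :
    pairing f (translate b g) = ∫ ξ, echar (inner ℝ b ξ) * (𝓕 f ξ * conj (𝓕 g ξ)) := by
  have h1 := fourier_toLp_ae_eq (memLp_one_iff_integrable.1 hf₁) hf₂
  have h2 := fourier_toLp_ae_eq (memLp_one_iff_integrable.1 hg₁) hg₂
  rw [pairing_congr hf₂.coeFn_toLp.symm (translate_congr b hg₂.coeFn_toLp.symm),
    pairing_translate_eq]
  apply integral_congr_ae
  filter_upwards [h1, h2] with ξ e1 e2
  rw [e1, e2]

theorem lintegral_windowCoefficient_sq :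
    ∫⁻ b, ‖pairing f (translate b g)‖ₑ ^ 2 = ∫⁻ ξ, ‖𝓕 f ξ‖ₑ ^ 2 * ‖𝓕 g ξ‖ₑ ^ 2 := by
  rw [lintegral_congr fun b => by rw [windowCoefficient_eq hf₁ hf₂ hg₁ hg₂ b],
    lintegral_echar_sq (integrable_fourier_mul_conj hf₁ hf₂ hg₁ hg₂)]
  refine lintegral_congr fun ξ => ?_
  rw [enorm_mul, enorm_conj, mul_pow]

/-- If the slicewise integrals of a function `q` are those of the frequency side, then `q`
represents the window coefficient. -/
theorem windowCoefficient_slices (x y : ℝ) (q : ℝ → ℂ)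
    (hq : ∀ᵐ v : ℝ, q v = ∫ τ : ℝ, echar ((x + v * y) * τ) *
      (((|τ| : ℝ) : ℂ) * (𝓕 f (cone (v, τ)) * conj (𝓕 g (cone (v, τ)))))) :
    Integrable q ∧ pairing f (translate !₂[x, y] g) = ∫ v, q v := by
  have hc : Continuous fun ξ : Plane => echar (inner ℝ !₂[x, y] ξ) :=
    continuous_echar.comp (by fun_prop)
  have hi := (integrable_fourier_mul_conj hf₁ hf₂ hg₁ hg₂).bdd_mul hc.aestronglyMeasurable
    (Filter.Eventually.of_forall fun ξ => (norm_echar _).le)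
  have key : (fun v : ℝ => ∫ τ : ℝ, ((|τ| : ℝ) : ℂ) * (echar (inner ℝ !₂[x, y] (cone (v, τ))) *
      (𝓕 f (cone (v, τ)) * conj (𝓕 g (cone (v, τ)))))) =ᵐ[volume] q := by
    filter_upwards [hq] with v hv
    rw [hv]
    refine integral_congr_ae (Filter.Eventually.of_forall fun τ => ?_)
    have e2 : inner ℝ !₂[x, y] (cone (v, τ)) = (x + v * y) * τ := by
      simp [cone, PiLp.inner_apply, Fin.sum_univ_two]
      ring
    simp only [e2]
    ring
  refine ⟨(integrable_cone hi).integral_prod_left.congr key, ?_⟩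
  rw [windowCoefficient_eq hf₁ hf₂ hg₁ hg₂, integral_cone hi]
  exact integral_congr_ae key

/-- The window coefficients through `J₀` of the Radon transforms. -/
theorem windowCoefficient_J0 (x y : ℝ) :
    Integrable (fun v : ℝ => pairing (J0 (toL2 (radonH f v)))
      (translate (x + v * y) (J0 (toL2 (radonH g v))))) volume
    ∧ pairing f (translate !₂[x, y] g)
      = ∫ v : ℝ, pairing (J0 (toL2 (radonH f v)))
          (translate (x + v * y) (J0 (toL2 (radonH g v)))) := by
  refine windowCoefficient_slices hf₁ hf₂ hg₁ hg₂ x y _ ?_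
  filter_upwards [ae_radonH hf₁ hf₂, ae_radonH hg₁ hg₂] with v h1 h2
  rw [pairing_translate_eq]
  apply integral_congr_ae
  filter_upwards [h1.2.1, h2.2.1, fourier_fourierMultiplier h1.2.2,
    fourier_fourierMultiplier h2.2.2] with τ t1 t2 t3 t4
  have e : inner ℝ (x + v * y) τ = (x + v * y) * τ := by simp [mul_comm]
  rw [e, J0, J0, t3, t4, t1, t2, ← abs_rpow_half_mul_self]
  simp only [map_mul, Complex.conj_ofReal]
  ring

/-- The window coefficients through `J₀²` of the Radon transform of the window. -/
theorem windowCoefficient_J0_sq (hJ : ∀ᵐ v : ℝ, InDomJ0 (J0 (toL2 (radonH g v)))) (x y : ℝ) :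
    Integrable (fun v : ℝ => pairing (radonH f v)
      (translate (x + v * y) (J0 (J0 (toL2 (radonH g v)))))) volume
    ∧ pairing f (translate !₂[x, y] g)
      = ∫ v : ℝ, pairing (radonH f v)
          (translate (x + v * y) (J0 (J0 (toL2 (radonH g v))))) := by
  refine windowCoefficient_slices hf₁ hf₂ hg₁ hg₂ x y _ ?_
  filter_upwards [ae_radonH hf₁ hf₂, ae_radonH hg₁ hg₂, hJ] with v h1 h2 h3
  rw [pairing_congr (toL2_coeFn h1.1).symm (Filter.EventuallyEq.refl _ _), pairing_translate_eq]
  apply integral_congr_ae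
  filter_upwards [h1.2.1, h2.2.1, fourier_fourierMultiplier h2.2.2,
    fourier_fourierMultiplier h3] with τ t1 t2 t3 t4
  have e : inner ℝ (x + v * y) τ = (x + v * y) * τ := by simp [mul_comm]
  change (𝓕 (J0 (toL2 (radonH g v))) : L2 ℝ) τ = _ at t3
  change (𝓕 (J0 (J0 (toL2 (radonH g v)))) : L2 ℝ) τ = _ at t4
  rw [e, t4, t3, t1, t2, ← abs_rpow_half_mul_self]
  simp only [map_mul, Complex.conj_ofReal]
  ring

end Window

/-! ### Vertical coefficients by interchange of coordinates -/

section Vertical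

theorem swapCoords_apply (x : Plane) : swapCoords x = !₂[x 1, x 0] := by
  ext i
  fin_cases i <;> simp [swapCoords, LinearIsometryEquiv.piLpCongrLeft_apply]

theorem swapCoords_swapCoords (x : Plane) : swapCoords (swapCoords x) = x := by
  ext i
  fin_cases i <;> simp [swapCoords_apply]

theorem swapCoords_measurableEmbedding : MeasurableEmbedding swapCoords :=
  swapCoords.toHomeomorph.measurableEmbedding

/-- The interchange of coordinates on `L²`. -/
def swapL2 (F : L2 Plane) : L2 Plane :=
  Lp.compMeasurePreserving swapCoords swapCoords.measurePreserving F

theorem swapL2_coeFn (F : L2 Plane) : swapL2 F =ᵐ[volume] fun x => F (swapCoords x) :=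
  Lp.coeFn_compMeasurePreserving F swapCoords.measurePreserving

theorem isTransposePair_swap :
    IsTransposePair swapCoords.toContinuousLinearEquiv swapCoords.toContinuousLinearEquiv 1 := by
  have h1 : Measure.map swapCoords (volume : Measure Plane) = volume :=
    swapCoords.measurePreserving.map_eq
  have h2 : Measure.map swapCoords.symm (volume : Measure Plane) = volume :=
    swapCoords.symm.measurePreserving.map_eq
  refine ⟨one_pos, fun x y => ?_, by simpa using h1, by simpa using h1, by simpa using h2⟩
  change inner ℝ (swapCoords x) y = inner ℝ x (swapCoords y)
  simp [swapCoords_apply, PiLp.inner_apply, Fin.sum_univ_two]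
  ring

theorem swapCoords_symm_apply (x : Plane) : swapCoords.symm x = swapCoords x := by
  rw [LinearIsometryEquiv.symm_apply_eq, swapCoords_swapCoords]

/-- The interchange is orthogonal and equal to its transpose: the case `b = 0`, `c = 1` of
`fourier_comp_affine`. -/
theorem fourier_swapL2 (F : L2 Plane) : (𝓕 (swapL2 F) : L2 Plane) = swapL2 (𝓕 F) := by
  have h := isTransposePair_swap
  have := fourier_comp_affine _ _ h.pos h.transpose h.map_left h.map_right h.map_symm F 0
    (swapL2 F) (by simpa using swapL2_coeFn F)
  apply Lp.ext
  refine this.trans ((swapL2_coeFn _).trans (Filter.Eventually.of_forall fun ξ => ?_)).symm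
  change _ = _ * _ * (𝓕 F : L2 Plane) (swapCoords.symm ξ)
  rw [swapCoords_symm_apply]
  simp [echar]

theorem vert_eq_swapL2 (ψ : L2 Plane) : vert ψ = swapL2 ψ := by
  have h : vert ψ = 𝓕⁻ (𝓕 (swapL2 ψ) : L2 Plane) := by
    rw [fourier_swapL2]
    rfl
  rw [h, FourierTransform.fourierInv_fourier_eq]

theorem pairing_comp_swap (f h : Plane → ℂ) :
    pairing (fun x => f (swapCoords x)) (fun x => h (swapCoords x)) = pairing f h :=
  swapCoords.measurePreserving.integral_comp swapCoords_measurableEmbedding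
    (fun x => f x * conj (h x))

/-- Conjugation by the permutation matrix `P` exchanges the vertical and horizontal dilations and
shears. -/
theorem swapCoords_act_dilV_shearV (s a : ℝ) (x : Plane) :
    swapCoords (act ((dilV a)⁻¹ * (shearV s)⁻¹) x) =
      act ((dilH a)⁻¹ * (shearH s)⁻¹) (swapCoords x) := by
  set P : Matrix (Fin 2) (Fin 2) ℝ := !![0, 1; 1, 0] with hP
  have hPP : P * P = 1 := by
    ext i j
    fin_cases i <;> fin_cases j <;> simp [hP]
  have hPi : P⁻¹ = P := Matrix.inv_eq_right_inv hPP
  have hsw : ∀ x, swapCoords x = act P x := fun x => by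
    rw [swapCoords_apply]
    ext i
    fin_cases i <;> simp [act, hP, Matrix.vecHead, Matrix.vecTail]
  have hA : dilV a = P * dilH a * P := by
    ext i j
    fin_cases i <;> fin_cases j <;> simp [hP, dilV, dilH]
  have hN : shearV s = P * shearH s * P := by
    ext i j
    fin_cases i <;> fin_cases j <;> simp [hP, shearV, shearH]
  rw [hsw, hsw, ← act_mul, ← act_mul, hA, hN, Matrix.mul_inv_rev, Matrix.mul_inv_rev,
    Matrix.mul_inv_rev, Matrix.mul_inv_rev, hPi]
  congr 1
  simp only [← Matrix.mul_assoc, hPP, Matrix.one_mul]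
  rw [Matrix.mul_assoc _ P P, hPP, Matrix.mul_one]

theorem swapCoords_act_dilV_shearH (s a : ℝ) (x : Plane) :
    swapCoords (act (dilV a * shearH s) x) = act (dilH a * (shearH s)ᵀ) (swapCoords x) := by
  rw [transpose_shearH, swapCoords_apply, swapCoords_apply]
  ext i
  fin_cases i <;> simp [act, dilH, dilV, shearH, shearV, Matrix.vecHead, Matrix.vecTail] <;>
    ring

theorem shearletTransformV_vert (ψ F : L2 Plane) (b : Plane) (s : ℝ) {a : ℝ} (ha : a ≠ 0) :
    shearletTransformV (vert ψ) F b s a =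
      shearletTransformH ψ (swapL2 F) (swapCoords b) s a := by
  obtain ⟨A, B, h, hA, hB⟩ := exists_isTransposePair_shearlet ha s
  have qA := quasiMeasurePreserving_of_map_eq A.continuous.measurable h.map_left
  have qs := swapCoords.measurePreserving.quasiMeasurePreserving
  have hact : ∀ x, act ((dilV a)⁻¹ * (shearV s)⁻¹) x = swapCoords (A (swapCoords x)) := fun x => by
    rw [hA, ← swapCoords_act_dilV_shearV, swapCoords_swapCoords]
  -- The swapped shearlet is known only almost everywhere, so composing with the affine map requires
  -- that null sets pull back to null sets.
  have q : Measure.QuasiMeasurePreserving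
      (fun x => act ((dilV a)⁻¹ * (shearV s)⁻¹) (x - b)) volume volume := by
    simp only [hact]
    exact (qs.comp (qA.comp qs)).comp (measurePreserving_sub_right volume b).quasiMeasurePreserving
  have hv : ∀ᵐ x, shearletV (vert ψ) b s a x = shearletH ψ (swapCoords b) s a (swapCoords x) := by
    filter_upwards [q.ae (swapL2_coeFn ψ)] with x hx
    rw [shearletV, shearletH, vert_eq_swapL2, hx, swapCoords_act_dilV_shearV, map_sub]
  rw [shearletTransformV, pairing_congr (Filter.EventuallyEq.refl _ _) hv, shearletTransformH,
    pairing_congr (swapL2_coeFn F) (Filter.EventuallyEq.refl _ _), ← pairing_comp_swap]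
  simp only [swapCoords_swapCoords]

theorem radonV_eq (f : Plane → ℂ) (v : ℝ) : radonV f v = radonH (fun x => f (swapCoords x)) v := by
  ext t
  simp [radonV, radonH, swapCoords_apply]

/-- Reflection of the angle in the diagonal. -/
theorem angular_swap {φ : ℝ → ℝ} (hp : Function.Periodic φ (2 * Real.pi)) {ξ : Plane} (h : ξ ≠ 0) :
    angular φ (swapCoords ξ) = angular (fun θ => φ (Real.pi / 2 - θ)) ξ := by
  have hz : (⟨ξ 0, ξ 1⟩ : ℂ) ≠ 0 := by
    intro h0
    apply h
    ext i
    fin_cases i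
    · exact congrArg Complex.re h0
    · exact congrArg Complex.im h0
  -- As a complex map the interchange is `z ↦ i * conj z`, so the angle `θ` becomes `π/2 - θ` modulo
  -- `2π`.
  have e : (⟨swapCoords ξ 0, swapCoords ξ 1⟩ : ℂ) = Complex.I * conj (⟨ξ 0, ξ 1⟩ : ℂ) := by
    rw [swapCoords_apply]
    apply Complex.ext <;> simp
  have h1 := Complex.arg_mul_coe_angle Complex.I_ne_zero ((map_ne_zero (starRingEnd ℂ)).2 hz)
  rw [Complex.arg_conj_coe_angle, Complex.arg_I, ← Real.Angle.coe_neg, ← Real.Angle.coe_add,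
    Real.Angle.angle_eq_iff_two_pi_dvd_sub] at h1
  obtain ⟨k, hk⟩ := h1
  rw [angular, e, angular]
  have h4 : Complex.arg (Complex.I * conj (⟨ξ 0, ξ 1⟩ : ℂ)) =
      Real.pi / 2 - Complex.arg ⟨ξ 0, ξ 1⟩ + k * (2 * Real.pi) := by linarith
  rw [h4, hp.int_mul k]

theorem swapL2_localize {φ : ℝ → ℝ} (hφ : Continuous φ) (hb : ∀ θ, φ θ ^ 2 ≤ 1)
    (hp : Function.Periodic φ (2 * Real.pi)) (F : L2 Plane) :
    swapL2 (localize φ F) = localize (fun θ => φ (Real.pi / 2 - θ)) (swapL2 F) := by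
  have hinj : ∀ u w : L2 Plane, (𝓕 u : L2 Plane) = 𝓕 w → u = w := fun u w h =>
    (Lp.fourierTransformₗᵢ Plane ℂ).injective h
  apply hinj
  rw [fourier_swapL2]
  apply Lp.ext
  have hφ' : Continuous fun θ => φ (Real.pi / 2 - θ) := by fun_prop
  have qs := swapCoords.measurePreserving.quasiMeasurePreserving (μa := (volume : Measure Plane))
  filter_upwards [swapL2_coeFn (𝓕 (localize φ F)), qs.ae (fourier_localize hφ hb F),
    fourier_localize hφ' (fun θ => hb _) (swapL2 F), swapL2_coeFn (𝓕 F),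
    Measure.ae_ne volume (0 : Plane)] with ξ h1 h2 h3 h4 h5
  rw [h1, h2, h3, fourier_swapL2, h4, angular_swap hp h5]

theorem memLp_comp_swap {f : Plane → ℂ} {p : ℝ≥0∞} (hf : MemLp f p) :
    MemLp (fun x => f (swapCoords x)) p :=
  hf.comp_measurePreserving swapCoords.measurePreserving

theorem swapL2_toLp {f : Plane → ℂ} (hf : MemLp f 2) :
    swapL2 (hf.toLp f) = (memLp_comp_swap hf).toLp _ := by
  apply Lp.ext
  have qs := swapCoords.measurePreserving.quasiMeasurePreserving (μa := (volume : Measure Plane))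
  filter_upwards [swapL2_coeFn (hf.toLp f), qs.ae hf.coeFn_toLp,
    (memLp_comp_swap hf).coeFn_toLp] with x h1 h2 h3
  rw [h1, h2, h3]

theorem ae_radonV {f : Plane → ℂ} (hf₁ : MemLp f 1) (hf₂ : MemLp f 2) :
    ∀ᵐ v : ℝ, MemLp (radonV f v) 2 := by
  filter_upwards [ae_radonH (memLp_comp_swap hf₁) (memLp_comp_swap hf₂)] with v hv
  rw [radonV_eq]
  exact hv.1

/-- `arctan v + arctan (1 / v)` is `π/2` or `-π/2` according to the sign of `v`; `π`-periodicity
absorbs the difference. -/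
theorem reflect_arctan {φ : ℝ → ℝ} (he : ∀ θ, φ (θ + Real.pi) = φ θ) {v : ℝ} (hv : v ≠ 0) :
    φ (Real.pi / 2 - Real.arctan v) = φ (Real.arctan (1 / v)) := by
  rw [one_div]
  rcases lt_or_gt_of_ne hv with h | h
  · rw [Real.arctan_inv_of_neg h, ← he (-(Real.pi / 2) - Real.arctan v)]
    congr 1
    ring
  · rw [Real.arctan_inv_of_pos h]

/-- Vertical shearlet coefficients through the wavelet transform of the Radon transform. -/
theorem shearletTransformV_localize {φ : ℝ → ℝ} (hφ : Continuous φ) (hb : ∀ θ, φ θ ^ 2 ≤ 1)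
    (he : ∀ θ, φ (θ + Real.pi) = φ θ) {ψ : L2 Plane} {ψ₁ ψ₂ : L2 ℝ}
    (hψ : IsSeparableShearlet ψ ψ₁ ψ₂) {f : Plane → ℂ} (hf₁ : MemLp f 1) (hf₂ : MemLp f 2)
    (x y s : ℝ) {a : ℝ} (ha : a ≠ 0) :
    Integrable (fun v : ℝ => waveletTransform (chi1 ψ₁) (radonV f v) (v * x + y) a
      * conj ((𝓕 ψ₂ : L2 ℝ) ((v - s) / |a| ^ (1 / 2 : ℝ))) * (φ (Real.arctan (1 / v)) : ℂ)) volume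
    ∧ shearletTransformV (vert ψ) (localize φ (hf₂.toLp f)) !₂[x, y] s a
      = ((|a| ^ (-3 / 4 : ℝ) : ℝ) : ℂ) *
        ∫ v : ℝ, waveletTransform (chi1 ψ₁) (radonV f v) (v * x + y) a
          * conj ((𝓕 ψ₂ : L2 ℝ) ((v - s) / |a| ^ (1 / 2 : ℝ)))
          * (φ (Real.arctan (1 / v)) : ℂ) := by
  have hp : Function.Periodic φ (2 * Real.pi) := by
    have : Function.Periodic φ Real.pi := he
    simpa using this.nat_mul 2
  have he' : ∀ θ, (fun θ => φ (Real.pi / 2 - θ)) (θ + Real.pi) = φ (Real.pi / 2 - θ) := fun θ => by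
    simp only []
    rw [← he]
    congr 1
    ring
  have hφ' : Continuous fun θ => φ (Real.pi / 2 - θ) := by fun_prop
  -- The horizontal formula for `f` with swapped coordinates: `x` and `y` change places and the
  -- cut-off is reflected in the diagonal.
  obtain ⟨h1, h2⟩ := shearletTransformH_localize hφ' (fun θ => hb _) he' hψ
    (memLp_comp_swap hf₁) (memLp_comp_swap hf₂) y x s ha
  have hae : (fun v : ℝ => waveletTransform (chi1 ψ₁) (radonH (fun x => f (swapCoords x)) v)
      (y + v * x) a * conj ((𝓕 ψ₂ : L2 ℝ) ((v - s) / |a| ^ (1 / 2 : ℝ)))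
      * (φ (Real.pi / 2 - Real.arctan v) : ℂ)) =ᵐ[volume]
      fun v : ℝ => waveletTransform (chi1 ψ₁) (radonV f v) (v * x + y) a
      * conj ((𝓕 ψ₂ : L2 ℝ) ((v - s) / |a| ^ (1 / 2 : ℝ))) * (φ (Real.arctan (1 / v)) : ℂ) := by
    -- At `v = 0` the convention `1 / 0 = 0` would give the angle `0` instead of `π/2`; a single
    -- point does not matter.
    filter_upwards [Measure.ae_ne volume (0 : ℝ)] with v hv
    rw [reflect_arctan he hv, radonV_eq, add_comm y]
  refine ⟨h1.congr hae, ?_⟩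
  rw [← integral_congr_ae hae, shearletTransformV_vert _ _ _ _ ha, swapL2_localize hφ hb hp,
    swapL2_toLp, ← h2, swapCoords_apply]
  rfl

/-- Two measure-preserving interchanges, one in `b` and one in `ξ`, reduce this to the horizontal
energy. -/
theorem lintegral_shearletTransformV_sq (ψ F : L2 Plane) (s : ℝ) {a : ℝ} (ha : a ≠ 0) :
    ∫⁻ b, ‖shearletTransformV (vert ψ) F b s a‖ₑ ^ 2 = ∫⁻ ξ, ‖(𝓕 F : L2 Plane) ξ‖ₑ ^ 2 *
      (‖a‖ₑ ^ (3 / 2 : ℝ) * ‖(𝓕 (vert ψ) : L2 Plane) (act (dilV a * shearH s) ξ)‖ₑ ^ 2) := by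
  have qs := swapCoords.measurePreserving.quasiMeasurePreserving (μa := (volume : Measure Plane))
  have hact : ∀ x, act (dilV a * shearH s) x =
      swapCoords (act (dilH a * (shearH s)ᵀ) (swapCoords x)) := fun x => by
    rw [← swapCoords_act_dilV_shearH, swapCoords_swapCoords]
  have q : Measure.QuasiMeasurePreserving (act (dilV a * shearH s)) volume volume := by
    have := qs.comp ((quasiMeasurePreserving_act_dilH_shearH ha s).comp qs)
    rwa [show act (dilV a * shearH s) = _ from funext hact]
  rw [lintegral_congr fun b => by rw [shearletTransformV_vert ψ F b s ha],
    swapCoords.measurePreserving.lintegral_comp_emb swapCoords_measurableEmbedding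
      (fun b => ‖shearletTransformH ψ (swapL2 F) b s a‖ₑ ^ 2),
    lintegral_shearletTransformH_sq ψ _ s ha,
    ← swapCoords.measurePreserving.lintegral_comp_emb swapCoords_measurableEmbedding]
  apply lintegral_congr_ae
  filter_upwards [qs.ae (swapL2_coeFn (𝓕 F)), q.ae (swapL2_coeFn (𝓕 ψ))] with ξ h1 h2
  rw [fourier_swapL2, h1, swapCoords_swapCoords, vert_eq_swapL2, fourier_swapL2, h2,
    swapCoords_act_dilV_shearH]

end Vertical

/-! ### The norm identity -/

section NormIdentity

theorem measurable_shearIntegral {K : ℝ → ℝ → Plane → ℝ≥0∞}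
    (hK : Measurable fun p : (ℝ × ℝ) × Plane => K p.1.1 p.1.2 p.2) (T : Set ℝ) :
    Measurable fun p : ℝ × Plane => (∫⁻ s in T, K p.1 s p.2) / ‖p.1‖ₑ ^ (3 / 2 : ℝ) := by
  have hK1 : Measurable fun p : (ℝ × Plane) × ℝ => K p.1.1 p.2 p.1.2 :=
    hK.comp (f := fun p : (ℝ × Plane) × ℝ => ((p.1.1, p.2), p.1.2)) (by fun_prop)
  have hI : Measurable fun p : ℝ × Plane => ∫⁻ s in T, K p.1 s p.2 := hK1.lintegral_prod_right'
  exact hI.div (measurable_fst.enorm.pow_const _)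

theorem measurable_scaleIntegral {K : ℝ → ℝ → Plane → ℝ≥0∞}
    (hK : Measurable fun p : (ℝ × ℝ) × Plane => K p.1.1 p.1.2 p.2) (S T : Set ℝ) :
    Measurable fun ξ => ∫⁻ a in S, (∫⁻ s in T, K a s ξ) / ‖a‖ₑ ^ (3 / 2 : ℝ) :=
  (measurable_shearIntegral hK T).lintegral_prod_left'

/-- Tonelli, first in `(s, ξ)` and then in `(a, ξ)`. The factor `|a|^{3/2}` of the coefficient
energy turns the measure `da / |a|³` into the `da / |a|^{3/2}` of the window condition. -/
theorem lintegral_scale_swap {P : Plane → ℝ≥0∞} (hP : Measurable P) {K : ℝ → ℝ → Plane → ℝ≥0∞}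
    (hK : Measurable fun p : (ℝ × ℝ) × Plane => K p.1.1 p.1.2 p.2) (S T : Set ℝ)
    (q : ℝ → ℝ → ℝ≥0∞)
    (hq : ∀ a ≠ 0, ∀ s, q a s = ∫⁻ ξ, P ξ * (‖a‖ₑ ^ (3 / 2 : ℝ) * K a s ξ)) :
    ∫⁻ a in S, (∫⁻ s in T, q a s) / ‖a‖ₑ ^ 3 =
      ∫⁻ ξ, P ξ * ∫⁻ a in S, (∫⁻ s in T, K a s ξ) / ‖a‖ₑ ^ (3 / 2 : ℝ) := by
  have hI := measurable_shearIntegral hK T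
  have hI2 : Measurable fun p : ℝ × Plane =>
      P p.2 * ((∫⁻ s in T, K p.1 s p.2) / ‖p.1‖ₑ ^ (3 / 2 : ℝ)) :=
    (hP.comp measurable_snd).mul hI
  calc ∫⁻ a in S, (∫⁻ s in T, q a s) / ‖a‖ₑ ^ 3
      = ∫⁻ a in S, ∫⁻ ξ, P ξ * ((∫⁻ s in T, K a s ξ) / ‖a‖ₑ ^ (3 / 2 : ℝ)) := by
        apply lintegral_congr_ae
        filter_upwards [Measure.ae_ne (volume.restrict S) (0 : ℝ)] with a ha
        have m1 : Measurable fun p : ℝ × Plane => P p.2 * (‖a‖ₑ ^ (3 / 2 : ℝ) * K a p.1 p.2) := by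
          refine (hP.comp measurable_snd).mul (Measurable.const_mul ?_ _)
          exact hK.comp (f := fun p : ℝ × Plane => ((a, p.1), p.2)) (by fun_prop)
        have h0 : ‖a‖ₑ ≠ 0 := enorm_ne_zero.2 ha
        have ht : ‖a‖ₑ ≠ ⊤ := enorm_ne_top
        rw [lintegral_congr fun s => hq a ha s, lintegral_lintegral_swap m1.aemeasurable,
          div_eq_mul_inv, ← lintegral_mul_const']
        · refine lintegral_congr fun ξ => ?_
          have m2 : Measurable fun s => K a s ξ :=
            hK.comp (f := fun s : ℝ => ((a, s), ξ)) (by fun_prop)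
          rw [lintegral_const_mul _ (m2.const_mul _), lintegral_const_mul _ m2, mul_assoc,
            mul_comm (‖a‖ₑ ^ (3 / 2 : ℝ)), mul_assoc, div_eq_mul_inv]
          congr 2
          rw [← ENNReal.rpow_natCast, ← ENNReal.rpow_neg, ← ENNReal.rpow_neg,
            ← ENNReal.rpow_add _ _ h0 ht]
          norm_num
        · exact ENNReal.inv_ne_top.2 (pow_ne_zero _ h0)
    _ = ∫⁻ ξ, ∫⁻ a in S, P ξ * ((∫⁻ s in T, K a s ξ) / ‖a‖ₑ ^ (3 / 2 : ℝ)) :=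
        lintegral_lintegral_swap hI2.aemeasurable
    _ = _ := by
        refine lintegral_congr fun ξ => ?_
        rw [lintegral_const_mul]
        exact hI.comp (f := fun a : ℝ => (a, ξ)) (by fun_prop)

/-- The chosen representative of an `L²` class is strongly measurable, so the kernel is jointly
measurable in scale, shear and frequency, as Tonelli requires. -/
theorem measurable_kernel (u : L2 Plane) {M : ℝ → ℝ → Matrix (Fin 2) (Fin 2) ℝ}
    (hM : ∀ i j, Measurable fun p : ℝ × ℝ => M p.1 p.2 i j) :
    Measurable fun p : (ℝ × ℝ) × Plane => ‖u (act (M p.1.1 p.1.2) p.2)‖ₑ ^ 2 := by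
  have h1 : Measurable fun p : (ℝ × ℝ) × Plane => act (M p.1.1 p.1.2) p.2 := by
    refine (PiLp.volume_preserving_toLp (Fin 2)).measurable.comp (measurable_pi_lambda _ fun i => ?_)
    simp only [Matrix.mulVec, dotProduct]
    refine Finset.measurable_sum _ fun j _ => ?_
    exact ((hM i j).comp measurable_fst).mul (by fun_prop)
  exact ((Lp.stronglyMeasurable u).measurable.comp h1).enorm.pow_const 2

theorem measurable_dilH_shear (i j : Fin 2) :
    Measurable fun p : ℝ × ℝ => (dilH p.1 * (shearH p.2)ᵀ) i j := by
  fin_cases i <;> fin_cases j <;> simp [dilH, transpose_shearH, shearV] <;> fun_prop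

theorem measurable_dilV_shear (i j : Fin 2) :
    Measurable fun p : ℝ × ℝ => (dilV p.1 * shearH p.2) i j := by
  fin_cases i <;> fin_cases j <;> simp [dilV, shearH] <;> fun_prop

theorem measurable_angular {φ : ℝ → ℝ} (hφ : Continuous φ) : Measurable (angular φ) :=
  hφ.measurable.comp (Complex.measurable_arg.comp
    (Complex.measurableEquivRealProd.symm.measurable.comp
      (Measurable.prodMk (by fun_prop) (by fun_prop) : Measurable fun ξ : Plane => (ξ 0, ξ 1))))

theorem enorm_fourier_localize_sq {φ : ℝ → ℝ} (hφ : Continuous φ) (hb : ∀ θ, φ θ ^ 2 ≤ 1)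
    {f : Plane → ℂ} (hf₁ : MemLp f 1) (hf₂ : MemLp f 2) :
    ∀ᵐ ξ, ‖(𝓕 (localize φ (hf₂.toLp f)) : L2 Plane) ξ‖ₑ ^ 2 =
      ‖𝓕 f ξ‖ₑ ^ 2 * ENNReal.ofReal (angular φ ξ ^ 2) := by
  filter_upwards [fourier_localize hφ hb (hf₂.toLp f),
    fourier_toLp_ae_eq (memLp_one_iff_integrable.1 hf₁) hf₂] with ξ h1 h2
  rw [h1, h2, enorm_mul, mul_pow, mul_comm]
  congr 1
  rw [← ofReal_norm, Complex.norm_real, ← ENNReal.ofReal_pow (norm_nonneg _), Real.norm_eq_abs,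
    sq_abs]

/-- The reproducing formula for the norm. -/
theorem norm_identity {φ φv : ℝ → ℝ} (hφ : Continuous φ) (hb : ∀ θ, φ θ ^ 2 ≤ 1)
    (hφv : Continuous φv) (hbv : ∀ θ, φv θ ^ 2 ≤ 1) {ψ : L2 Plane} {g : Plane → ℂ}
    (hg₁ : MemLp g 1) (hg₂ : MemLp g 2) (hW : WindowCondition φ φv ψ g)
    {f : Plane → ℂ} (hf₁ : MemLp f 1) (hf₂ : MemLp f 2) :
    eLpNorm f 2 volume ^ 2
      = (∫⁻ b : Plane, ‖pairing f (translate b g)‖ₑ ^ 2)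
        + (∫⁻ a in Icc (-1 : ℝ) 1, (∫⁻ s in Icc (-2 : ℝ) 2, ∫⁻ b : Plane,
            ‖shearletTransformH ψ (localize φ (hf₂.toLp f)) b s a‖ₑ ^ 2) / ‖a‖ₑ ^ 3)
        + (∫⁻ a in Icc (-1 : ℝ) 1, (∫⁻ s in Icc (-2 : ℝ) 2, ∫⁻ b : Plane,
            ‖shearletTransformV (vert ψ) (localize φv (hf₂.toLp f)) b s a‖ₑ ^ 2) / ‖a‖ₑ ^ 3) := by
  have hfi := memLp_one_iff_integrable.1 hf₁
  have mf : Measurable fun ξ => ‖𝓕 f ξ‖ₑ ^ 2 :=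
    (continuous_fourier_of_integrable hfi).measurable.enorm.pow_const 2
  have mg : Measurable fun ξ => ‖𝓕 g ξ‖ₑ ^ 2 := (continuous_fourier_of_integrable
    (memLp_one_iff_integrable.1 hg₁)).measurable.enorm.pow_const 2
  have mfg : Measurable fun ξ => ‖𝓕 f ξ‖ₑ ^ 2 * ‖𝓕 g ξ‖ₑ ^ 2 := mf.mul mg
  have mP : ∀ {φ : ℝ → ℝ}, Continuous φ → Measurable fun ξ =>
      ‖𝓕 f ξ‖ₑ ^ 2 * ENNReal.ofReal (angular φ ξ ^ 2) := fun h =>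
    mf.mul ((measurable_angular h).pow_const 2).ennreal_ofReal
  have mH := measurable_kernel (M := fun a s => dilH a * (shearH s)ᵀ) (𝓕 ψ) measurable_dilH_shear
  have mV := measurable_kernel (M := fun a s => dilV a * shearH s) (𝓕 (vert ψ))
    measurable_dilV_shear
  rw [lintegral_windowCoefficient_sq hf₁ hf₂ hg₁ hg₂,
    lintegral_scale_swap (K := fun a s ξ =>
      ‖(𝓕 ψ : L2 Plane) (act (dilH a * (shearH s)ᵀ) ξ)‖ₑ ^ 2) (mP hφ) mH _ _
      (fun a s => ∫⁻ b : Plane, ‖shearletTransformH ψ (localize φ (hf₂.toLp f)) b s a‖ₑ ^ 2),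
    lintegral_scale_swap (K := fun a s ξ =>
      ‖(𝓕 (vert ψ) : L2 Plane) (act (dilV a * shearH s) ξ)‖ₑ ^ 2) (mP hφv) mV _ _
      (fun a s => ∫⁻ b : Plane,
        ‖shearletTransformV (vert ψ) (localize φv (hf₂.toLp f)) b s a‖ₑ ^ 2),
    eLpNorm_two_sq, ← lintegral_fourier_sq hfi, ← lintegral_add_left mfg,
    ← lintegral_add_left']
  -- With `|𝓕 f|²` factored out, the remaining sum is the left side of the window condition.
  · apply lintegral_congr_ae
    filter_upwards [hW] with ξ hξ
    simp only [mul_assoc, ← mul_add]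
    rw [hξ, mul_one]
  · exact (mfg.add ((mP hφ).mul (measurable_scaleIntegral (K := fun a s ξ =>
      ‖(𝓕 ψ : L2 Plane) (act (dilH a * (shearH s)ᵀ) ξ)‖ₑ ^ 2) mH _ _))).aemeasurable
  · intro a ha s
    rw [lintegral_shearletTransformV_sq ψ _ s ha]
    apply lintegral_congr_ae
    filter_upwards [enorm_fourier_localize_sq hφv hbv hf₁ hf₂] with ξ h
    rw [h]
  · intro a ha s
    rw [lintegral_shearletTransformH_sq ψ _ s ha]
    apply lintegral_congr_ae
    filter_upwards [enorm_fourier_localize_sq hφ hb hf₁ hf₂] with ξ h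
    rw [h]

end NormIdentity

end ConeShearlet

end

open ConeShearlet in
theorem theorem4p1
    (ε : ℝ) (hε : 0 < ε) (hε' : ε < Real.pi / 4)
    (φ φv : ℝ → ℝ) (hφ : IsAngularPartition ε φ φv)
    (ψ : L2 Plane) (ψ₁ ψ₂ : L2 ℝ) (hψ : IsSeparableShearlet ψ ψ₁ ψ₂)
    (g : Plane → ℂ) (hg : ContDiff ℝ ∞ g) (hg₁ : MemLp g 1 volume) (hg₂ : MemLp g 2 volume)
    (hW : WindowCondition φ φv ψ g)
    (f : Plane → ℂ) (hf₁ : MemLp f 1 volume) (hf₂ : MemLp f 2 volume) :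
    -- the norm identity, in `[0, ∞]`
    eLpNorm f 2 volume ^ 2
        = (∫⁻ b : Plane, ‖pairing f (translate b g)‖ₑ ^ 2)
          + (∫⁻ a in Icc (-1 : ℝ) 1, (∫⁻ s in Icc (-2 : ℝ) 2, ∫⁻ b : Plane,
              ‖shearletTransformH ψ (localize φ (hf₂.toLp f)) b s a‖ₑ ^ 2) / ‖a‖ₑ ^ 3)
          + (∫⁻ a in Icc (-1 : ℝ) 1, (∫⁻ s in Icc (-2 : ℝ) 2, ∫⁻ b : Plane,
              ‖shearletTransformV (vert ψ) (localize φv (hf₂.toLp f)) b s a‖ₑ ^ 2) / ‖a‖ₑ ^ 3)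
    -- the Radon transforms at almost every direction are square-integrable
    ∧ (∀ᵐ v : ℝ, MemLp (radonH f v) 2 volume) ∧ (∀ᵐ v : ℝ, MemLp (radonV f v) 2 volume)
    -- the horizontal coefficients
    ∧ (∀ x y s a : ℝ, a ≠ 0 →
        Integrable (fun v : ℝ => waveletTransform (chi1 ψ₁) (radonH f v) (x + v * y) a
          * conj ((𝓕 ψ₂ : L2 ℝ) ((v - s) / |a| ^ (1 / 2 : ℝ))) * (φ (Real.arctan v) : ℂ)) volume
        ∧ shearletTransformH ψ (localize φ (hf₂.toLp f)) !₂[x, y] s a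
          = ((|a| ^ (-3 / 4 : ℝ) : ℝ) : ℂ) *
            ∫ v : ℝ, waveletTransform (chi1 ψ₁) (radonH f v) (x + v * y) a
              * conj ((𝓕 ψ₂ : L2 ℝ) ((v - s) / |a| ^ (1 / 2 : ℝ))) * (φ (Real.arctan v) : ℂ))
    -- the vertical coefficients
    ∧ (∀ x y s a : ℝ, a ≠ 0 →
        Integrable (fun v : ℝ => waveletTransform (chi1 ψ₁) (radonV f v) (v * x + y) a
          * conj ((𝓕 ψ₂ : L2 ℝ) ((v - s) / |a| ^ (1 / 2 : ℝ)))
          * (φv (Real.arctan (1 / v)) : ℂ)) volume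
        ∧ shearletTransformV (vert ψ) (localize φv (hf₂.toLp f)) !₂[x, y] s a
          = ((|a| ^ (-3 / 4 : ℝ) : ℝ) : ℂ) *
            ∫ v : ℝ, waveletTransform (chi1 ψ₁) (radonV f v) (v * x + y) a
              * conj ((𝓕 ψ₂ : L2 ℝ) ((v - s) / |a| ^ (1 / 2 : ℝ)))
              * (φv (Real.arctan (1 / v)) : ℂ))
    -- the window coefficients, with `J₀` on both sides
    ∧ (∀ᵐ v : ℝ, InDomJ0 (toL2 (radonH f v)))
    ∧ (∀ᵐ v : ℝ, MemLp (radonH g v) 2 volume ∧ InDomJ0 (toL2 (radonH g v)))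
    ∧ (∀ x y : ℝ,
        Integrable (fun v : ℝ => pairing (J0 (toL2 (radonH f v)))
          (translate (x + v * y) (J0 (toL2 (radonH g v))))) volume
        ∧ pairing f (translate !₂[x, y] g)
          = ∫ v : ℝ, pairing (J0 (toL2 (radonH f v)))
              (translate (x + v * y) (J0 (toL2 (radonH g v)))))
    -- the window coefficients, with `ζ(v, ·) = J₀² (R g)(v, ·)` whenever this is defined
    ∧ ((∀ᵐ v : ℝ, InDomJ0 (J0 (toL2 (radonH g v)))) →
        ∀ x y : ℝ,
          Integrable (fun v : ℝ => pairing (radonH f v)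
            (translate (x + v * y) (J0 (J0 (toL2 (radonH g v)))))) volume
          ∧ pairing f (translate !₂[x, y] g)
            = ∫ v : ℝ, pairing (radonH f v)
                (translate (x + v * y) (J0 (J0 (toL2 (radonH g v)))))) := by
  have hb : ∀ θ, φ θ ^ 2 ≤ 1 := fun θ => by
    linarith [hφ.sq_add_sq θ, sq_nonneg (φv θ)]
  have hbv : ∀ θ, φv θ ^ 2 ≤ 1 := fun θ => by
    linarith [hφ.sq_add_sq θ, sq_nonneg (φ θ)]
  have hc := hφ.smoothH.continuous
  have hcv := hφ.smoothV.continuous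
  refine ⟨norm_identity hc hb hcv hbv hg₁ hg₂ hW hf₁ hf₂, (ae_radonH hf₁ hf₂).mono fun v h => h.1,
    ae_radonV hf₁ hf₂, fun x y s a ha => shearletTransformH_localize hc hb hφ.evenH hψ hf₁ hf₂ x y s ha,
    fun x y s a ha => shearletTransformV_localize hcv hbv hφ.evenV hψ hf₁ hf₂ x y s ha,
    (ae_radonH hf₁ hf₂).mono fun v h => h.2.2,
    (ae_radonH hg₁ hg₂).mono fun v h => ⟨h.1, h.2.2⟩,
    windowCoefficient_J0 hf₁ hf₂ hg₁ hg₂, windowCoefficient_J0_sq hf₁ hf₂ hg₁ hg₂⟩
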